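/- Let $M_r$ be the algebra of complex $r\times r$ matrices with unit $I$, and $\Omega=\{(x,t):0\le t\le x\le 1\}$. Let $H\in L_2((-1,1),M_r)$ be an accelerant, i.e. $H$ is even and for every $a\in[0,1]$ the equation $f(x)+\int_0^a H(x-t)f(t)\,dt=0$, $x\in(0,1)$, has only the zero solution in $L_2((0,1),\mathbb C^r)$. Then the Krein equation $$R(x,t)+H(x-t)+\int_0^x R(x,\xi)H(\xi-t)\,d\xi=0,\qquad (x,t)\in\Omega,$$ has a unique solution $R=R_H$ in $L_2(\Omega,M_r)$; put $$\tau(x)=[\Theta(H)](x):=H(x)+\int_0^x R(x,\xi)H(\xi)\,d\xi ,\qquad x\in(0,1),$$ which is a function in $L_2((0,1),M_r)$. For $\lambda\in\mathbb C$ let $\varphi(\cdot,\lambda,\tau)$ and $\psi(\cdot,\lambda,\tau)$ be the $M_r$-valued solutions on $[0,1]$ of the Cauchy problems $$-\Bigl(\tfrac{d}{dx}+\tau\Bigr)\Bigl(\tfrac{d}{dx}-\tau\Bigr)\varphi=\lambda^2\varphi,\quad \varphi(0)=0,\quad (\varphi'-\tau\varphi)(0)=\lambda I,$$ $$-\Bigl(\tfrac{d}{dx}-\tau\Bigr)\Bigl(\tfrac{d}{dx}+\tau\Bigr)\psi=\lambda^2\psi,\quad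 \psi(0)=I,\quad (\psi'+\tau\psi)(0)=0,$$ in the classes of functions $\varphi$, resp. $\psi$, in $W_2^1((0,1),M_r)$ with $\varphi'-\tau\varphi$, resp. $\psi'+\tau\psi$, in $W_2^1((0,1),M_r)$. Let $G_2^+$ be the class of kernels $K\in L_2((0,1)^2,M_r)$, vanishing a.e. on $[0,1]^2\setminus\Omega$, for which $x\mapsto K(x,\cdot)$ and $t\mapsto K(\cdot,t)$ are continuous from $[0,1]$ to $L_2((0,1),M_r)$. Then there exist kernels $K_{\tau,D},K_{\tau,N}\in G_2^+$ such that for all $\lambda\in\mathbb C$ and $x\in[0,1]$ $$\varphi(x,\lambda,\tau)=\sin(\lambda x)\,I+\int_0^x \sin(\lambda t)\,K_{\tau,D}(x,t)\,dt,\qquad \psi(x,\lambda,\tau)=\cos(\lambda x)\,I+\int_0^x \cos(\lambda t)\,K_{\tau,N}(x,t)\,dt,$$ and any such kernels are given, for almost every $(x,t)\in\Omega$, by $$K_{\tau,D}(x,t)=\frac12\left[R\Bigl(x,\frac{x+t}2\Bigr)-R\Bigl(x,\frac{x-t}2\Bigr)\right],\qquad K_{\tau,N}(x,t)=\frac12\left[R\Bigl(x,\frac{x+t}2\Bigr)+R\Bigl(x,\frac{x-t}2\Bigr)\right].$$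 -/

import Mathlib

open MeasureTheory Set Filter Topology
open scoped Matrix.Norms.L2Operator

/-- The algebra `M_r` of complex `r × r` matrices (with the operator norm on Euclidean `ℂ^r`). -/
abbrev Mr (r : ℕ) : Type := Matrix (Fin r) (Fin r) ℂ

/-- Lebesgue measure on `(0,1)`. -/
noncomputable def mu01 : Measure ℝ := volume.restrict (Ioo (0 : ℝ) 1)

/-- The triangle `Ω = {(x,t) : 0 ≤ t ≤ x ≤ 1}`. -/
def Omega : Set (ℝ × ℝ) := {p | 0 ≤ p.2 ∧ p.2 ≤ p.1 ∧ p.1 ≤ 1}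

/-- `H` (any representative) is an accelerant: it is in `L_2((-1,1), M_r)`, it is even, and for
every `a ∈ [0,1]` the equation `f(x) + ∫_0^a H(x-t) f(t) dt = 0`, `x ∈ (0,1)`, has only the
trivial solution `f ∈ L_2((0,1), ℂ^r)`. -/
structure IsAccelerant {r : ℕ} (H : ℝ → Mr r) : Prop where
  memLp : MemLp H 2 (volume.restrict (Ioo (-1 : ℝ) 1))
  even : ∀ᵐ x ∂(volume.restrict (Ioo (-1 : ℝ) 1)), H (-x) = H x
  trivial_ker : ∀ a ∈ Icc (0 : ℝ) 1, ∀ f : ℝ → EuclideanSpace ℂ (Fin r),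
    MemLp f 2 mu01 →
    (∀ᵐ x ∂mu01,
      f x + ∫ t in (0 : ℝ)..a, (Matrix.toEuclideanCLM (𝕜 := ℂ) (H (x - t))) (f t) = 0) →
    ∀ᵐ x ∂mu01, f x = 0

/-- `R ∈ L_2(Ω, M_r)` solves the Krein equation
`R(x,t) + H(x-t) + ∫_0^x R(x,ξ) H(ξ-t) dξ = 0` on `Ω`. -/
structure IsKreinSolution {r : ℕ} (H : ℝ → Mr r) (R : ℝ → ℝ → Mr r) : Prop where
  memLp : MemLp (fun p : ℝ × ℝ => R p.1 p.2) 2 (volume.restrict Omega)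
  eqn : ∀ᵐ p ∂(volume.restrict Omega),
    R p.1 p.2 + H (p.1 - p.2) + ∫ ξ in (0 : ℝ)..p.1, R p.1 ξ * H (ξ - p.2) = 0

/-- The value of `Θ(H)`, where `R` is the Krein solution of `H`:
`Θ(H)(x) = H(x) + ∫_0^x R(x,ξ) H(ξ) dξ`. -/
noncomputable def theta {r : ℕ} (H : ℝ → Mr r) (R : ℝ → ℝ → Mr r) (x : ℝ) : Mr r :=
  H x + ∫ ξ in (0 : ℝ)..x, R x ξ * H ξ

/-- `u` is (the continuous representative of) a function in `W_2^1((0,1), M_r)` and `v ∈ L_2` is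
its derivative; equivalently, `u` is absolutely continuous on `[0,1]` with `u' = v` a.e. -/
def IsW12 {r : ℕ} (u v : ℝ → Mr r) : Prop :=
  MemLp v 2 mu01 ∧ ∀ x ∈ Icc (0 : ℝ) 1, u x = u 0 + ∫ t in (0 : ℝ)..x, v t

/-- `u ∈ W_2^1` has quasi-derivative `w = u' - τ u ∈ W_2^1` and solves
`-(d/dx + τ)(d/dx - τ) u = l² u` on `(0,1)`, `u(0) = A`, `w(0) = B`. -/
def IsCauchySolution {r : ℕ} (τ : ℝ → Mr r) (l : ℂ) (A B : Mr r) (u : ℝ → Mr r) : Prop :=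
  ∃ u' w w' : ℝ → Mr r, IsW12 u u' ∧ IsW12 w w' ∧
    (∀ᵐ x ∂mu01, w x = u' x - τ x * u x) ∧
    (∀ᵐ x ∂mu01, -(w' x + τ x * w x) = l ^ 2 • u x) ∧
    u 0 = A ∧ w 0 = B

/-- `φ = φ(·, l, τ)`: `-(d/dx + τ)(d/dx - τ) φ = l² φ`, `φ(0) = 0`, `(φ' - τ φ)(0) = l I`. -/
def IsPhi {r : ℕ} (τ : ℝ → Mr r) (l : ℂ) (φ : ℝ → Mr r) : Prop :=
  IsCauchySolution τ l 0 (l • (1 : Mr r)) φ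

/-- `ψ = ψ(·, l, τ)`: `-(d/dx - τ)(d/dx + τ) ψ = l² ψ`, `ψ(0) = I`, `(ψ' + τ ψ)(0) = 0`. -/
def IsPsi {r : ℕ} (τ : ℝ → Mr r) (l : ℂ) (ψ : ℝ → Mr r) : Prop :=
  IsCauchySolution (fun x => -τ x) l 1 0 ψ

/-- The class `G_2^+`: kernels `K ∈ L_2((0,1)², M_r)` such that `x ↦ K(x,·)` and `t ↦ K(·,t)` are
continuous from `[0,1]` to `L_2((0,1), M_r)`, and `K(x,t) = 0` a.e. in `[0,1]² \ Ω`. -/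
structure InG2Plus {r : ℕ} (K : ℝ → ℝ → Mr r) : Prop where
  memLp : MemLp (fun p : ℝ × ℝ => K p.1 p.2) 2
    (volume.restrict (Icc (0 : ℝ) 1 ×ˢ Icc (0 : ℝ) 1))
  memLp_left : ∀ x ∈ Icc (0 : ℝ) 1, MemLp (fun t => K x t) 2 mu01
  continuous_left : ∀ x₀ ∈ Icc (0 : ℝ) 1,
    Tendsto (fun x => eLpNorm (fun t => K x t - K x₀ t) 2 mu01) (𝓝[Icc 0 1] x₀) (𝓝 0)
  memLp_right : ∀ t ∈ Icc (0 : ℝ) 1, MemLp (fun x => K x t) 2 mu01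
  continuous_right : ∀ t₀ ∈ Icc (0 : ℝ) 1,
    Tendsto (fun t => eLpNorm (fun x => K x t - K x t₀) 2 mu01) (𝓝[Icc 0 1] t₀) (𝓝 0)
  lower : ∀ᵐ p ∂(volume.restrict ((Icc (0 : ℝ) 1 ×ˢ Icc (0 : ℝ) 1) \ Omega)), K p.1 p.2 = 0

/-- `K` is the transformation kernel `K_{τ,D}`: it lies in `G_2^+` and, for every `l ∈ ℂ`, the
Cauchy problem for `φ(·, l, τ)` is solvable and its solution is
`φ(x) = sin(l x) I + ∫_0^x sin(l t) K(x,t) dt` on `[0,1]`. -/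
def IsKernelD {r : ℕ} (τ : ℝ → Mr r) (K : ℝ → ℝ → Mr r) : Prop :=
  InG2Plus K ∧ ∀ l : ℂ, (∃ φ, IsPhi τ l φ) ∧ ∀ φ, IsPhi τ l φ → ∀ x ∈ Icc (0 : ℝ) 1,
    φ x = Complex.sin (l * x) • (1 : Mr r) + ∫ t in (0 : ℝ)..x, Complex.sin (l * t) • K x t

/-- `K` is the transformation kernel `K_{τ,N}`: it lies in `G_2^+` and, for every `l ∈ ℂ`, the
Cauchy problem for `ψ(·, l, τ)` is solvable and its solution is
`ψ(x) = cos(l x) I + ∫_0^x cos(l t) K(x,t) dt` on `[0,1]`. -/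
def IsKernelN {r : ℕ} (τ : ℝ → Mr r) (K : ℝ → ℝ → Mr r) : Prop :=
  InG2Plus K ∧ ∀ l : ℂ, (∃ ψ, IsPsi τ l ψ) ∧ ∀ ψ, IsPsi τ l ψ → ∀ x ∈ Icc (0 : ℝ) 1,
    ψ x = Complex.cos (l * x) • (1 : Mr r) + ∫ t in (0 : ℝ)..x, Complex.cos (l * t) • K x t

/-! Write the Krein solution as `R(x,t) = -H(x-t) - C(x,t)`. The whole L² singularity of `R` sits in
the explicit term, and `C` is jointly continuous. It solves `C + T_x C = -∫_0^x H(x-ξ)H(ξ-·) dξ`,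
where `T_x f = ∫_0^x f(ξ)H(ξ-·) dξ` acts on C([0,1]). Each `T_a` is compact, so `1 + T_a` is
invertible once it is injective. The accelerant condition gives injectivity for multiplication by
`H` from the left; a duality pairing carries it over to multiplication from the right
(`eq_zero_of_right_convolution`). Norm continuity in `a` makes the inverses continuous and uniformly
bounded. At `t = 0` the definition of `C` gives `τ(x) = H(x) + C(x,0) = -R(x,0)`.

The central identity is Bellman–Krein, `R(x,x-u) = R(u,0) + ∫_u^x R(y,0)R(y,u) dy`
(`bellman_krein`). It is proved without differentiating anything: the defect of the identity
satisfies a truncated convolution equation whose right-hand side does not depend on `x`, the defect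
vanishes at `u = x`, and a Gronwall argument forces it to be zero.

Put `p_l(x) = e^{ilx}(1 + ∫_0^x e^{-2ilu} R(x,x-u) du)`. Bellman–Krein and Fubini give the Krein
system `p_l' = il p_l - τ p_{-l}`, `p_l(0) = 1` (`kreinExp_eq`). Hence `φ = (p_l - p_{-l})/(2i)` and
`ψ = (p_l + p_{-l})/2` satisfy `φ' = lψ + τφ`, `ψ' = -lφ - τψ`, which contains both Cauchy problems.
The definition of `p_l` reads `φ(x) = sin(lx) + ∫_0^x sin(l(2s-x)) R(x,s) ds`, likewise for `ψ` with
cosines. The substitution `t = 2s - x` and the parity of sine and cosine fold the integral onto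
`(0,x)`, which produces the two kernels.

Uniqueness for the Cauchy problem (`IsCauchySolution.eqOn`) makes the representation hold for every
solution. Completeness of sines and cosines on `(0,x)` with `x ≤ 1 < π` shows that any other kernel
agrees with the constructed one on each slice. -/

/-! ### Families of L² functions depending continuously on a parameter -/

section L2Continuity

open scoped ENNReal

variable {X : Type*} [TopologicalSpace X] {E : Type*} [NormedAddCommGroup E]

/-- A family of square-integrable functions on the line depending continuously, in the `L²`-norm,
on a parameter. -/
def L2Continuous (F : X → ℝ → E) : Prop :=
  (∀ x, MemLp (F x) 2 volume) ∧
    ∀ x₀, Tendsto (fun x => eLpNorm (F x - F x₀) 2 volume) (𝓝 x₀) (𝓝 0)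

/-- Bridge between pointwise representatives and the space `Lp`: closure properties of
`L2Continuous` are inherited from the normed space. -/
theorem l2Continuous_iff {F : X → ℝ → E} :
    L2Continuous F ↔ ∃ h : ∀ x, MemLp (F x) 2 volume, Continuous fun x => (h x).toLp (F x) := by
  constructor
  · rintro ⟨h, hc⟩
    refine ⟨h, continuous_iff_continuousAt.2 fun x₀ => ?_⟩
    exact (Lp.tendsto_Lp_iff_tendsto_eLpNorm'' _ h _ (h x₀)).2 (hc x₀)
  · rintro ⟨h, hc⟩
    refine ⟨h, fun x₀ => ?_⟩
    exact (Lp.tendsto_Lp_iff_tendsto_eLpNorm'' _ h _ (h x₀)).1 (hc.tendsto x₀)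

theorem L2Continuous.comp {X' : Type*} [TopologicalSpace X'] {F : X → ℝ → E}
    (hF : L2Continuous F) {g : X' → X} (hg : Continuous g) : L2Continuous fun x => F (g x) :=
  ⟨fun _ => hF.1 _, fun x₀ => (hF.2 (g x₀)).comp (hg.tendsto x₀)⟩

theorem l2Continuous_const {f : ℝ → E} (hf : MemLp f 2 volume) :
    L2Continuous fun _ : X => f :=
  ⟨fun _ => hf, fun _ => by simp⟩

theorem L2Continuous.neg {F : X → ℝ → E} (hF : L2Continuous F) :
    L2Continuous fun x ξ => -F x ξ := by
  refine ⟨fun x => (hF.1 x).neg, fun x₀ => (hF.2 x₀).congr fun x => ?_⟩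
  rw [← eLpNorm_neg]
  congr 1
  ext ξ
  simp
  abel

theorem L2Continuous.add {F G : X → ℝ → E} (hF : L2Continuous F) (hG : L2Continuous G) :
    L2Continuous fun x ξ => F x ξ + G x ξ := by
  obtain ⟨h1, c1⟩ := l2Continuous_iff.1 hF
  obtain ⟨h2, c2⟩ := l2Continuous_iff.1 hG
  exact l2Continuous_iff.2 ⟨fun x => (h1 x).add (h2 x), c1.add c2⟩

theorem L2Continuous.sub {F G : X → ℝ → E} (hF : L2Continuous F) (hG : L2Continuous G) :
    L2Continuous fun x ξ => F x ξ - G x ξ := by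
  simpa only [sub_eq_add_neg] using hF.add hG.neg

/-- Strong continuity of translations in L², in general form: currying makes `g` continuous into
C(ℝ,ℝ) with the compact-open topology, where composition with measure-preserving maps is continuous
in L². -/
theorem l2Continuous_comp_measurePreserving {f : ℝ → E} (hf : MemLp f 2 volume) {g : X → ℝ → ℝ}
    (hg : Continuous (Function.uncurry g))
    (hgm : ∀ x, MeasurePreserving (g x) volume volume) : L2Continuous fun x ξ => f (g x ξ) := by
  refine l2Continuous_iff.2 ⟨fun x => hf.comp_measurePreserving (hgm x), ?_⟩
  let G : C(X, C(ℝ, ℝ)) := ContinuousMap.curry ⟨Function.uncurry g, hg⟩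
  exact Continuous.compMeasurePreservingLp (f := fun _ : X => hf.toLp f) continuous_const
    G.continuous hgm (by simp)

theorem l2Continuous_translate {f : ℝ → E} (hf : MemLp f 2 volume) :
    L2Continuous fun s ξ => f (ξ - s) :=
  l2Continuous_comp_measurePreserving hf (by fun_prop)
    fun s => measurePreserving_sub_right volume s

theorem l2Continuous_translate_add {f : ℝ → E} (hf : MemLp f 2 volume) :
    L2Continuous fun s ξ => f (ξ + s) :=
  l2Continuous_comp_measurePreserving hf (by fun_prop)
    fun s => measurePreserving_add_right volume s

theorem l2Continuous_reflect {f : ℝ → E} (hf : MemLp f 2 volume) :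
    L2Continuous fun s ξ => f (s - ξ) :=
  l2Continuous_comp_measurePreserving hf (by fun_prop)
    fun s => Measure.measurePreserving_sub_left volume s

/-- The pairing of two L² functions is bounded and bilinear, hence jointly continuous. Continuity of
`C` rests on this: it is an integral of products of L² functions. -/
theorem L2Continuous.integral_bilin [NormedSpace ℂ E] [CompleteSpace E] (L : E →L[ℂ] E →L[ℂ] E)
    {F G : X → ℝ → E} (hF : L2Continuous F) (hG : L2Continuous G) :
    Continuous fun x => ∫ ξ, L (F x ξ) (G x ξ) := by
  obtain ⟨h1, c1⟩ := l2Continuous_iff.1 hF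
  obtain ⟨h2, c2⟩ := l2Continuous_iff.1 hG
  have : (fun x => ∫ ξ, L (F x ξ) (G x ξ)) = fun x =>
      L.lpPairing volume 2 2 ((h1 x).toLp _) ((h2 x).toLp _) := by
    ext x
    rw [ContinuousLinearMap.lpPairing_eq_integral]
    refine integral_congr_ae ?_
    filter_upwards [(h1 x).coeFn_toLp, (h2 x).coeFn_toLp] with ξ e1 e2
    simp [e1, e2]
  rw [this]
  fun_prop

/-- Dominated convergence in `L²`. -/
theorem tendsto_eLpNorm_two_of_dominated [FirstCountableTopology X] {F : X → ℝ → E} {x₀ : X}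
    (hF : ∀ x, MemLp (F x) 2 volume) {g : ℝ → ℝ} (hg : MemLp g 2 volume)
    (hb : ∀ᶠ x in 𝓝 x₀, ∀ᵐ ξ, ‖F x ξ - F x₀ ξ‖ ≤ g ξ)
    (hl : ∀ᵐ ξ, Tendsto (fun x => F x ξ) (𝓝 x₀) (𝓝 (F x₀ ξ))) :
    Tendsto (fun x => eLpNorm (F x - F x₀) 2 volume) (𝓝 x₀) (𝓝 0) := by
  have key : Tendsto (fun x => ∫⁻ ξ, ‖(F x - F x₀) ξ‖ₑ ^ (2 : ℝ)) (𝓝 x₀)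
      (𝓝 (∫⁻ _ : ℝ, 0)) := by
    refine tendsto_lintegral_filter_of_dominated_convergence' (fun ξ => ‖g ξ‖ₑ ^ (2 : ℝ))
      (Eventually.of_forall fun x => ?_) ?_ ?_ ?_
    · exact (((hF x).1.sub (hF x₀).1).enorm.pow_const 2)
    · filter_upwards [hb] with x hx
      filter_upwards [hx] with ξ hξ
      gcongr
      rw [← ofReal_norm, ← ofReal_norm]
      exact ENNReal.ofReal_le_ofReal (hξ.trans (le_abs_self _))
    · have := hg.2
      rw [eLpNorm_eq_lintegral_rpow_enorm_toReal (by simp) (by simp)] at this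
      simp only [ENNReal.toReal_ofNat] at this
      exact ((ENNReal.rpow_lt_top_iff_of_pos (by norm_num)).1 this).ne
    · filter_upwards [hl] with ξ hξ
      have h1 : Tendsto (fun x => ‖F x ξ - F x₀ ξ‖ₑ) (𝓝 x₀) (𝓝 0) := by
        have := (hξ.sub_const (F x₀ ξ)).enorm
        simpa using this
      have h2 := h1.ennrpow_const 2
      rwa [ENNReal.zero_rpow_of_pos (by norm_num)] at h2
  have h2 := key.ennrpow_const (1 / 2)
  simp only [lintegral_zero] at h2
  rw [ENNReal.zero_rpow_of_pos (by norm_num)] at h2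
  refine h2.congr fun x => ?_
  rw [eLpNorm_eq_lintegral_rpow_enorm_toReal (by simp) (by simp)]
  simp

/-- Moving the function costs at most its L² increment, whatever the cut-off. Moving the cut-off of
a fixed function is dominated convergence; pointwise convergence can fail only at the two limiting
endpoints. -/
theorem L2Continuous.indicator_Ioc [FirstCountableTopology X] {F : X → ℝ → E}
    (hF : L2Continuous F) {a b : X → ℝ} (ha : Continuous a) (hb : Continuous b) :
    L2Continuous fun x => (Ioc (a x) (b x)).indicator (F x) := by
  refine ⟨fun x => (hF.1 x).indicator measurableSet_Ioc, fun x₀ => ?_⟩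
  have h1 : Tendsto (fun x => eLpNorm ((Ioc (a x) (b x)).indicator (F x₀) -
      (Ioc (a x₀) (b x₀)).indicator (F x₀)) 2 volume) (𝓝 x₀) (𝓝 0) := by
    refine tendsto_eLpNorm_two_of_dominated
      (F := fun x => (Ioc (a x) (b x)).indicator (F x₀))
      (fun x => (hF.1 x₀).indicator measurableSet_Ioc) (g := fun ξ => ‖F x₀ ξ‖) (hF.1 x₀).norm
      (Eventually.of_forall fun x => Eventually.of_forall fun ξ => ?_) ?_
    · by_cases h : ξ ∈ Ioc (a x) (b x) <;> by_cases h' : ξ ∈ Ioc (a x₀) (b x₀) <;> simp [h, h']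
    · have e1 : ∀ᵐ ξ : ℝ, ξ ≠ a x₀ := by simp [ae_iff]
      have e2 : ∀ᵐ ξ : ℝ, ξ ≠ b x₀ := by simp [ae_iff]
      filter_upwards [e1, e2] with ξ h1 h2
      refine tendsto_const_nhds.congr' ?_
      have ea : ∀ᶠ x in 𝓝 x₀, (a x < ξ ↔ a x₀ < ξ) := by
        rcases lt_or_gt_of_ne h1 with h | h
        · filter_upwards [ha.continuousAt.eventually_const_lt h] with x hx
          simp only [hx.not_gt, h.not_gt]
        · filter_upwards [ha.continuousAt.eventually_lt_const h] with x hx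
          simp only [hx, h]
      have eb : ∀ᶠ x in 𝓝 x₀, (ξ ≤ b x ↔ ξ ≤ b x₀) := by
        rcases lt_or_gt_of_ne h2 with h | h
        · filter_upwards [hb.continuousAt.eventually_const_lt h] with x hx
          simp [hx.le, h.le]
        · filter_upwards [hb.continuousAt.eventually_lt_const h] with x hx
          simp [hx.not_ge, h.not_ge]
      filter_upwards [ea, eb] with x h1 h2
      simp [indicator, h1, h2]
  have h2 := (hF.2 x₀).add h1
  rw [add_zero] at h2
  refine tendsto_of_tendsto_of_tendsto_of_le_of_le tendsto_const_nhds h2 (fun _ => zero_le) fun x => ?_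
  have e : (Ioc (a x) (b x)).indicator (F x) - (Ioc (a x₀) (b x₀)).indicator (F x₀) =
      (Ioc (a x) (b x)).indicator (F x - F x₀) + ((Ioc (a x) (b x)).indicator (F x₀) -
      (Ioc (a x₀) (b x₀)).indicator (F x₀)) := by
    rw [indicator_sub']; abel
  have m := fun x y => (hF.1 x).1.indicator (measurableSet_Ioc (a := a y) (b := b y))
  simp only [e]
  refine (eLpNorm_add_le ?_ ((m _ _).sub (m _ _)) (by norm_num)).trans ?_
  · exact ((hF.1 x).1.sub (hF.1 x₀).1).indicator measurableSet_Ioc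
  · gcongr
    exact eLpNorm_indicator_le _

theorem Continuous.memLp_restrict_Icc {c : ℝ → E} (hc : Continuous c) (a b : ℝ)
    {p : ℝ≥0∞} : MemLp c p (volume.restrict (Icc a b)) := by
  obtain ⟨C, hC⟩ := isCompact_Icc.exists_bound_of_continuousOn (hc.continuousOn (s := Icc a b))
  exact MemLp.of_bound hc.aestronglyMeasurable C (ae_restrict_of_forall_mem measurableSet_Icc hC)

theorem l2Continuous_indicator_of_continuous [FirstCountableTopology X] {c : X → ℝ → E}
    (hc : Continuous (Function.uncurry c)) (a b : ℝ) :
    L2Continuous fun x => (Ioc a b).indicator (c x) := by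
  have hcx : ∀ x, Continuous (c x) := fun x => hc.comp (by fun_prop : Continuous fun t => (x, t))
  have hm : ∀ x, MemLp ((Ioc a b).indicator (c x)) 2 volume := fun x => by
    rw [memLp_indicator_iff_restrict measurableSet_Ioc]
    exact ((hcx x).memLp_restrict_Icc a b).mono_measure
      (Measure.restrict_mono Ioc_subset_Icc_self le_rfl)
  refine ⟨hm, fun x₀ => ?_⟩
  have hd : Continuous fun p : X × ℝ => ‖c p.1 p.2 - c x₀ p.2‖ :=
    (hc.sub ((hcx x₀).comp continuous_snd)).norm
  refine tendsto_eLpNorm_two_of_dominated hm (g := (Ioc a b).indicator fun _ => (1 : ℝ))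
    ?_ ?_ ?_
  · exact memLp_indicator_const 2 measurableSet_Ioc _ (by simp)
  -- Tube lemma: for `x` near `x₀` the increment is below 1 uniformly on the compact interval, which
  -- supplies the dominating function.
  · have := isCompact_Icc (a := a) (b := b) |>.eventually_forall_of_forall_eventually (x₀ := x₀)
      (P := fun x ξ => ‖c x ξ - c x₀ ξ‖ < 1)
      (fun ξ _ => hd.continuousAt.eventually_lt_const (by simp))
    filter_upwards [this] with x hx
    refine Eventually.of_forall fun ξ => ?_
    by_cases h : ξ ∈ Ioc a b
    · simpa [h] using (hx ξ ⟨h.1.le, h.2⟩).le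
    · simp [h]
  · refine Eventually.of_forall fun ξ => ?_
    by_cases h : ξ ∈ Ioc a b
    · simp only [h, indicator_of_mem]
      exact (hc.comp (by fun_prop : Continuous fun x => (x, ξ))).tendsto x₀
    · simp [h]

theorem L2Continuous.intervalIntegral_bilin [NormedSpace ℂ E] [CompleteSpace E]
    [FirstCountableTopology X] (L : E →L[ℂ] E →L[ℂ] E) {F G : X → ℝ → E} (hF : L2Continuous F)
    (hG : L2Continuous G) {a b : X → ℝ} (ha : Continuous a) (hb : Continuous b) :
    Continuous fun x => ∫ ξ in a x..b x, L (F x ξ) (G x ξ) := by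
  have key : ∀ {a b : X → ℝ}, Continuous a → Continuous b →
      Continuous fun x => ∫ ξ in Ioc (a x) (b x), L (F x ξ) (G x ξ) := by
    intro a b ha hb
    refine ((hF.indicator_Ioc ha hb).integral_bilin L hG).congr fun x => ?_
    rw [← integral_indicator measurableSet_Ioc]
    congr 1
    ext ξ
    by_cases h : ξ ∈ Ioc (a x) (b x) <;> simp [h]
  exact (key ha hb).sub (key hb ha)

theorem L2Continuous.intervalIntegral_mul {A : Type*} [NormedRing A] [NormedAlgebra ℂ A]
    [CompleteSpace A] [FirstCountableTopology X] {F G : X → ℝ → A} (hF : L2Continuous F)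
    (hG : L2Continuous G) {a b : X → ℝ} (ha : Continuous a) (hb : Continuous b) :
    Continuous fun x => ∫ ξ in a x..b x, F x ξ * G x ξ :=
  hF.intervalIntegral_bilin (ContinuousLinearMap.mul ℂ A) hG ha hb

end L2Continuity

/-! ### Truncated convolution operators on C([0,1]) -/

section ConvolutionOperator

open scoped ENNReal unitInterval

variable {A : Type*} [NormedRing A]

theorem integral_norm_mul_norm_le {α E : Type*} [MeasurableSpace α] {μ : Measure α}
    [NormedAddCommGroup E] {F G : α → E} (hF : MemLp F 2 μ) (hG : MemLp G 2 μ) :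
    ∫ ξ, ‖F ξ‖ * ‖G ξ‖ ∂μ ≤ √(∫ ξ, ‖F ξ‖ ^ 2 ∂μ) * √(∫ ξ, ‖G ξ‖ ^ 2 ∂μ) := by
  have := integral_mul_le_Lp_mul_Lq_of_nonneg (μ := μ) Real.HolderConjugate.two_two
    (f := fun ξ => ‖F ξ‖) (g := fun ξ => ‖G ξ‖) (Eventually.of_forall fun _ => norm_nonneg _)
    (Eventually.of_forall fun _ => norm_nonneg _) (by simpa using hF.norm) (by simpa using hG.norm)
  simpa [Real.sqrt_eq_rpow] using this

theorem sqrt_integral_norm_sq_eq {α E : Type*} [MeasurableSpace α] {μ : Measure α}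
    [NormedAddCommGroup E] {G : α → E} (hG : MemLp G 2 μ) :
    √(∫ ξ, ‖G ξ‖ ^ 2 ∂μ) = (eLpNorm G 2 μ).toReal := by
  rw [hG.eLpNorm_eq_integral_rpow_norm (by simp) (by simp), ENNReal.toReal_ofReal (by positivity)]
  simp [Real.sqrt_eq_rpow]

theorem sqrt_integral_norm_sq_le_of_bound {F : ℝ → A} {a b K : ℝ} (hab : a ≤ b) (hK : 0 ≤ K)
    (h : ∀ ξ ∈ Ioc a b, ‖F ξ‖ ≤ K) : √(∫ ξ in a..b, ‖F ξ‖ ^ 2) ≤ K * √(b - a) := by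
  have h1 : ‖∫ ξ in a..b, ‖F ξ‖ ^ 2‖ ≤ K ^ 2 * |b - a| := by
    refine intervalIntegral.norm_integral_le_of_norm_le_const fun ξ hξ => ?_
    rw [uIoc_of_le hab] at hξ
    rw [norm_pow, norm_norm]
    gcongr
    exact h ξ hξ
  rw [abs_of_nonneg (sub_nonneg.2 hab)] at h1
  calc √(∫ ξ in a..b, ‖F ξ‖ ^ 2) ≤ √(K ^ 2 * (b - a)) := Real.sqrt_le_sqrt ((le_abs_self _).trans h1)
    _ = K * √(b - a) := by rw [Real.sqrt_mul (by positivity), Real.sqrt_sq hK]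

/-- The extension of a continuous function on `[0,1]` to the line, constant on both sides. -/
noncomputable def lineExtend (f : C(I, A)) : ℝ → A := IccExtend (zero_le_one' ℝ) f

theorem continuous_lineExtend (f : C(I, A)) : Continuous (lineExtend f) :=
  f.continuous.Icc_extend'

theorem norm_lineExtend_le (f : C(I, A)) (x : ℝ) : ‖lineExtend f x‖ ≤ ‖f‖ :=
  f.norm_coe_le_norm _

theorem lineExtend_of_mem (f : C(I, A)) {x : ℝ} (hx : x ∈ Icc (0 : ℝ) 1) :
    lineExtend f x = f ⟨x, hx⟩ :=
  IccExtend_of_mem _ _ hx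

theorem memLp_lineExtend (f : C(I, A)) (a b : ℝ) :
    MemLp (lineExtend f) 2 (volume.restrict (Ioc a b)) :=
  ((continuous_lineExtend f).memLp_restrict_Icc a b).mono_measure
    (Measure.restrict_mono Ioc_subset_Icc_self le_rfl)

theorem memLp_translate {H : ℝ → A} (hH : MemLp H 2 volume) (t : ℝ) :
    MemLp (fun ξ => H (ξ - t)) 2 volume :=
  (l2Continuous_translate hH).1 t

theorem eLpNorm_translate {H : ℝ → A} (hH : MemLp H 2 volume) (t : ℝ) :
    eLpNorm (fun ξ => H (ξ - t)) 2 volume = eLpNorm H 2 volume :=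
  eLpNorm_comp_measurePreserving hH.1 (measurePreserving_sub_right volume t)

variable [NormedAlgebra ℂ A]

theorem integrable_bilin_of_memLp {α : Type*} [MeasurableSpace α] {μ : Measure α}
    (L : A →L[ℂ] A →L[ℂ] A) {F G : α → A} (hF : MemLp F 2 μ) (hG : MemLp G 2 μ) :
    Integrable (fun ξ => L (F ξ) (G ξ)) μ :=
  memLp_one_iff_integrable.1 (L.memLp_of_bilin (p := 2) (q := 2) 1 hF hG)

/-- Cauchy–Schwarz. The bilinear map `L` is kept general so that one theory covers multiplication by
`H` from the right (`mul`) and from the left (`mul` flipped). -/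
theorem norm_intervalIntegral_bilin_le (L : A →L[ℂ] A →L[ℂ] A) {F G : ℝ → A} {a b : ℝ}
    (hab : a ≤ b) (hF : MemLp F 2 (volume.restrict (Ioc a b))) (hG : MemLp G 2 volume) :
    ‖∫ ξ in a..b, L (F ξ) (G ξ)‖ ≤
      ‖L‖ * (√(∫ ξ in a..b, ‖F ξ‖ ^ 2) * (eLpNorm G 2 volume).toReal) := by
  rw [intervalIntegral.integral_of_le hab, intervalIntegral.integral_of_le hab]
  have hG' := hG.restrict (Ioc a b)
  calc ‖∫ ξ in Ioc a b, L (F ξ) (G ξ)‖ ≤ ∫ ξ in Ioc a b, ‖L‖ * (‖F ξ‖ * ‖G ξ‖) := by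
        refine norm_integral_le_of_norm_le ?_ (Eventually.of_forall fun ξ => ?_)
        · exact (hF.norm.integrable_mul hG'.norm).const_mul _
        · rw [← mul_assoc]
          exact L.le_opNorm₂ _ _
    _ = ‖L‖ * ∫ ξ in Ioc a b, ‖F ξ‖ * ‖G ξ‖ := integral_const_mul _ _
    _ ≤ _ := by
        gcongr
        refine (integral_norm_mul_norm_le hF hG').trans ?_
        rw [sqrt_integral_norm_sq_eq hG']
        gcongr
        · exact hG.2.ne
        · exact Measure.restrict_le_self

theorem intervalIntegrable_bilin_translate (L : A →L[ℂ] A →L[ℂ] A) {H F : ℝ → A}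
    (hH : MemLp H 2 volume) (hF : Continuous F) (t a b : ℝ) :
    IntervalIntegrable (fun ξ => L (F ξ) (H (ξ - t))) volume a b := by
  have : ∀ a b : ℝ, IntegrableOn (fun ξ => L (F ξ) (H (ξ - t))) (Ioc a b) volume := fun a b =>
    integrable_bilin_of_memLp L ((hF.memLp_restrict_Icc a b).mono_measure
      (Measure.restrict_mono Ioc_subset_Icc_self le_rfl)) ((memLp_translate hH t).restrict _)
  exact ⟨this a b, this b a⟩

variable [CompleteSpace A]

theorem continuous_intervalIntegral_bilin_translate (L : A →L[ℂ] A →L[ℂ] A) {H F : ℝ → A}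
    (hH : MemLp H 2 volume) (hF : Continuous F) (a b : ℝ) :
    Continuous fun t => ∫ ξ in a..b, L (F ξ) (H (ξ - t)) := by
  have h1 := (l2Continuous_indicator_of_continuous (X := ℝ) (c := fun _ => F) (by fun_prop)
    (min a b) (max a b)).intervalIntegral_bilin L (l2Continuous_translate hH)
    (continuous_const (y := a)) (continuous_const (y := b))
  refine h1.congr fun t => intervalIntegral.integral_congr_ae (Eventually.of_forall fun ξ hξ => ?_)
  rw [indicator_of_mem (by simpa [uIoc] using hξ)]

/-- The truncated convolution operator `f ↦ ∫_0^a L(f(ξ), H(ξ - ·)) dξ` on `C([0,1])`. -/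
noncomputable def convOp (L : A →L[ℂ] A →L[ℂ] A) {H : ℝ → A} (hH : MemLp H 2 volume) (a : I) :
    C(I, A) →L[ℂ] C(I, A) :=
  LinearMap.mkContinuous
    { toFun := fun f => ⟨fun t => ∫ ξ in (0 : ℝ)..a, L (lineExtend f ξ) (H (ξ - t)),
        (continuous_intervalIntegral_bilin_translate L hH (continuous_lineExtend f) 0 a).comp
          continuous_subtype_val⟩
      map_add' := fun f g => by
        ext t
        have hi := fun f => intervalIntegrable_bilin_translate L hH (continuous_lineExtend f) t 0 a
        simp only [ContinuousMap.coe_mk, ContinuousMap.add_apply]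
        rw [← intervalIntegral.integral_add (hi f) (hi g)]
        simp [lineExtend, IccExtend]
      map_smul' := fun c f => by
        ext t
        simp only [ContinuousMap.coe_mk, ContinuousMap.smul_apply, RingHom.id_apply]
        rw [← intervalIntegral.integral_smul]
        simp [lineExtend, IccExtend] }
    (‖L‖ * (eLpNorm H 2 volume).toReal) fun f => by
      refine (ContinuousMap.norm_le _ (by positivity)).2 fun t => ?_
      refine (norm_intervalIntegral_bilin_le L a.2.1 (memLp_lineExtend f 0 a)
        (memLp_translate hH t)).trans ?_
      rw [eLpNorm_translate hH, mul_assoc, mul_comm _ ‖f‖]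
      gcongr
      refine (sqrt_integral_norm_sq_le_of_bound a.2.1 (norm_nonneg f)
        fun ξ _ => norm_lineExtend_le f ξ).trans ?_
      refine mul_le_of_le_one_right (norm_nonneg _) (Real.sqrt_le_one.2 ?_)
      simpa using a.2.2

theorem convOp_apply (L : A →L[ℂ] A →L[ℂ] A) {H : ℝ → A} (hH : MemLp H 2 volume) (a : I)
    (f : C(I, A)) (t : I) :
    convOp L hH a f t = ∫ ξ in (0 : ℝ)..a, L (lineExtend f ξ) (H (ξ - t)) := rfl

/-- The difference integrates over `(a,b]` only, so Cauchy–Schwarz yields the factor `√(b-a)`. This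
is what makes the inverses depend continuously on the truncation. -/
theorem norm_convOp_sub_le (L : A →L[ℂ] A →L[ℂ] A) {H : ℝ → A} (hH : MemLp H 2 volume) (a b : I)
    (hab : a ≤ b) : ‖convOp L hH b - convOp L hH a‖ ≤
      ‖L‖ * (eLpNorm H 2 volume).toReal * √(b - a) := by
  refine ContinuousLinearMap.opNorm_le_bound _ (by positivity) fun f => ?_
  refine (ContinuousMap.norm_le _ (by positivity)).2 fun t => ?_
  have hi := fun x y => intervalIntegrable_bilin_translate L hH (continuous_lineExtend f) t x y
  simp only [_root_.sub_apply, ContinuousMap.sub_apply, convOp_apply]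
  rw [intervalIntegral.integral_interval_sub_left (hi _ _) (hi _ _)]
  refine (norm_intervalIntegral_bilin_le L hab (memLp_lineExtend f _ _)
    (memLp_translate hH t)).trans ?_
  rw [eLpNorm_translate hH]
  calc _ ≤ ‖L‖ * (‖f‖ * √(b - a) * (eLpNorm H 2 volume).toReal) := by
        gcongr
        exact sqrt_integral_norm_sq_le_of_bound hab (norm_nonneg f)
          fun ξ _ => norm_lineExtend_le f ξ
    _ = _ := by ring

theorem continuous_convOp (L : A →L[ℂ] A →L[ℂ] A) {H : ℝ → A} (hH : MemLp H 2 volume) :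
    Continuous (convOp L hH) := by
  refine continuous_iff_continuousAt.2 fun a => ?_
  refine (tendsto_iff_norm_sub_tendsto_zero (E := C(I, A) →L[ℂ] C(I, A))).2 ?_
  have h : ∀ b : I, ‖convOp L hH b - convOp L hH a‖ ≤
      ‖L‖ * (eLpNorm H 2 volume).toReal * √|(b : ℝ) - a| := fun b => by
    rcases le_total a b with h | h
    · rw [abs_of_nonneg (sub_nonneg.2 (Subtype.coe_le_coe.2 h))]
      exact norm_convOp_sub_le L hH a b h
    · rw [abs_sub_comm, abs_of_nonneg (sub_nonneg.2 (Subtype.coe_le_coe.2 h))]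
      refine (norm_sub_rev (convOp L hH b) (convOp L hH a)).trans_le ?_
      exact norm_convOp_sub_le L hH b a h
  refine squeeze_zero (fun b => norm_nonneg (convOp L hH b - convOp L hH a)) h ?_
  have : Continuous fun b : I => ‖L‖ * (eLpNorm H 2 volume).toReal * √|(b : ℝ) - a| := by fun_prop
  simpa using this.tendsto a

/-- Arzelà–Ascoli: values stay in a closed ball, compact because `A` is proper, and the images of
the unit ball are equicontinuous because translation of `H` is continuous in L². -/
theorem isCompactOperator_convOp [ProperSpace A] (L : A →L[ℂ] A →L[ℂ] A) {H : ℝ → A}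
    (hH : MemLp H 2 volume) (a : I) : IsCompactOperator (convOp L hH a) := by
  rw [isCompactOperator_iff_exists_mem_nhds_image_subset_compact]
  refine ⟨Metric.closedBall 0 1, Metric.closedBall_mem_nhds _ one_pos, ?_⟩
  let e := ContinuousMap.equivBoundedOfCompact I A
  let S : Set (BoundedContinuousFunction I A) := e '' (convOp L hH a '' Metric.closedBall 0 1)
  have hS : IsCompact (closure S) := by
    refine BoundedContinuousFunction.arzela_ascoli
      (Metric.closedBall 0 ‖convOp L hH a‖) (isCompact_closedBall _ _) S ?_ ?_
    · rintro _ t ⟨_, ⟨f, hf, rfl⟩, rfl⟩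
      rw [mem_closedBall_zero_iff] at hf ⊢
      refine ((convOp L hH a f).norm_coe_le_norm t).trans ?_
      exact (ContinuousLinearMap.le_opNorm _ _).trans (mul_le_of_le_one_right (norm_nonneg _) hf)
    · intro t₀
      rw [Metric.equicontinuousAt_iff_right]
      intro ε hε
      have h1 : Tendsto (fun t : I => ‖L‖ * (eLpNorm ((fun ξ => H (ξ - t)) - fun ξ => H (ξ - t₀)) 2
          volume).toReal) (𝓝 t₀) (𝓝 0) := by
        have h2 := ((l2Continuous_translate hH).comp
          (continuous_subtype_val : Continuous fun t : I => (t : ℝ))).2 t₀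
        simpa using ((ENNReal.tendsto_toReal ENNReal.zero_ne_top).comp h2).const_mul ‖L‖
      filter_upwards [h1.eventually_lt_const hε] with t ht
      rintro ⟨_, _, ⟨f, hf, rfl⟩, rfl⟩
      rw [mem_closedBall_zero_iff] at hf
      refine lt_of_le_of_lt ?_ ht
      change dist (convOp L hH a f t₀) (convOp L hH a f t) ≤ _
      rw [dist_comm, dist_eq_norm, convOp_apply, convOp_apply, ← intervalIntegral.integral_sub
        (intervalIntegrable_bilin_translate L hH (continuous_lineExtend f) _ _ _)
        (intervalIntegrable_bilin_translate L hH (continuous_lineExtend f) _ _ _)]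
      simp only [← map_sub]
      refine (norm_intervalIntegral_bilin_le L a.2.1 (memLp_lineExtend f 0 a)
        ((memLp_translate hH t).sub (memLp_translate hH t₀))).trans ?_
      gcongr
      refine mul_le_of_le_one_left (by positivity) ?_
      refine (sqrt_integral_norm_sq_le_of_bound a.2.1 zero_le_one
        fun ξ _ => (norm_lineExtend_le f ξ).trans hf).trans ?_
      simpa using a.2.2
  refine ⟨e.symm '' closure S, hS.image ?_, ?_⟩
  · exact (ContinuousMap.isometryEquivBoundedOfCompact I A).symm.continuous
  · rintro g hg
    exact ⟨e g, subset_closure ⟨g, hg, rfl⟩, e.symm_apply_apply g⟩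

/-- Fredholm alternative at the point `-1`: it is an eigenvalue, which `h` excludes, or it lies in
the resolvent set. -/
theorem isUnit_one_add_convOp [ProperSpace A] (L : A →L[ℂ] A →L[ℂ] A) {H : ℝ → A}
    (hH : MemLp H 2 volume) (a : I) (h : ∀ f, f + convOp L hH a f = 0 → f = 0) :
    IsUnit (1 + convOp L hH a) := by
  rcases (isCompactOperator_convOp L hH a).hasEigenvalue_or_mem_resolventSet
    (μ := (-1 : ℂ)) (by simp) with h1 | h1
  · obtain ⟨f, hf⟩ := h1.exists_hasEigenvector
    refine absurd (h f ?_) hf.2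
    have := hf.apply_eq_smul
    simp only [ContinuousLinearMap.coe_coe] at this
    simp [this]
  · rw [spectrum.mem_resolventSet_iff, ← IsUnit.neg_iff] at h1
    simpa [add_comm] using h1

end ConvolutionOperator

/-! ### Integrability on products -/

section Product

variable {α β A : Type*} [MeasurableSpace α] [MeasurableSpace β] [NormedRing A]

/-- A measure-preserving shear turns `H(x-y)` into a function of one variable, which is
square-integrable because `ν` is finite. -/
theorem memLp_two_sub_prod {H : ℝ → A} (hH : MemLp H 2 volume) (ν : Measure ℝ)
    [IsFiniteMeasure ν] : MemLp (fun p : ℝ × ℝ => H (p.1 - p.2)) 2 (volume.prod ν) := by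
  have h1 : MemLp (fun p : ℝ × ℝ => H p.2) 2 (ν.prod volume) := hH.comp_snd ν
  have h2 : MeasurePreserving (fun p : ℝ × ℝ => (p.1, p.2 - p.1)) (ν.prod volume)
      (ν.prod volume) :=
    (MeasurePreserving.id ν).skew_product (g := fun y x => x - y) (by fun_prop)
      (Eventually.of_forall fun y => (measurePreserving_sub_right volume y).map_eq)
  exact (h1.comp_measurePreserving h2).comp_measurePreserving Measure.measurePreserving_swap

/-- Both `‖F‖ ⊗ ‖G‖` and `‖K‖` are L² on the product. This is the hypothesis for every use of Fubini
with a Krein-type kernel. -/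
theorem integrable_mul_mul_prod {μ : Measure α} {ν : Measure β} [SFinite μ] [SFinite ν]
    {F : α → A} {K : α × β → A} {G : β → A} (hF : MemLp F 2 μ) (hK : MemLp K 2 (μ.prod ν))
    (hG : MemLp G 2 ν) : Integrable (fun p : α × β => F p.1 * K p * G p.2) (μ.prod ν) := by
  have h1 : MemLp (fun p : α × β => ‖F p.1‖ * ‖G p.2‖) 2 (μ.prod ν) := by
    rw [memLp_two_iff_integrable_sq (by
      exact (hF.1.comp_fst.norm).mul hG.1.comp_snd.norm)]
    simp only [mul_pow]
    exact hF.norm.integrable_sq.mul_prod hG.norm.integrable_sq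
  refine (h1.integrable_mul hK.norm).mono' ((hF.1.comp_fst.mul hK.1).mul hG.1.comp_snd)
    (Eventually.of_forall fun p => ?_)
  refine (norm_mul_le _ _).trans ?_
  calc ‖F p.1 * K p‖ * ‖G p.2‖ ≤ ‖F p.1‖ * ‖K p‖ * ‖G p.2‖ := by
        gcongr
        exact norm_mul_le _ _
    _ = _ := by simp only [Pi.mul_apply]; ring

end Product

/-! ### Solving the Krein equation with a continuous remainder -/

section Resolvent

open scoped ENNReal unitInterval ComplexOrder

variable {A : Type*} [NormedRing A] [NormedAlgebra ℂ A]

theorem intervalIntegrable_mul_translate {H F : ℝ → A} (hH : MemLp H 2 volume) (hF : Continuous F)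
    (t a b : ℝ) : IntervalIntegrable (fun ξ => F ξ * H (ξ - t)) volume a b :=
  intervalIntegrable_bilin_translate (ContinuousLinearMap.mul ℂ A) hH hF t a b

variable [CompleteSpace A]

theorem continuous_mul_convolution {H F : ℝ → A} (hH : MemLp H 2 volume) (hF : Continuous F)
    (a b : ℝ) : Continuous fun t => ∫ ξ in a..b, F ξ * H (ξ - t) :=
  continuous_intervalIntegral_bilin_translate (ContinuousLinearMap.mul ℂ A) hH hF a b

/-- Inversion is continuous at units, so the inverses form a continuous, hence bounded, family over
the compact parameter space. -/
theorem exists_solution_operator {X Y : Type*} [TopologicalSpace X] [CompactSpace X]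
    [NormedAddCommGroup Y] [NormedSpace ℂ Y] [CompleteSpace Y] {B : X → Y →L[ℂ] Y}
    (hB : Continuous B) (hU : ∀ x, IsUnit (1 + B x)) :
    ∃ S : X → Y →L[ℂ] Y, Continuous S ∧ (∀ x y, S x y + B x (S x y) = y) ∧
      (∀ x y, S x (y + B x y) = y) ∧ ∃ M, 0 ≤ M ∧ ∀ x y, ‖S x y‖ ≤ M * ‖y‖ := by
  have hinv : Continuous fun x => Ring.inverse (1 + B x) := by
    refine continuous_iff_continuousAt.2 fun x => ?_
    obtain ⟨u, hu⟩ := hU x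
    have h1 := NormedRing.inverse_continuousAt u
    rw [hu] at h1
    exact ContinuousAt.comp (f := fun x => 1 + B x) h1 (continuous_const.add hB).continuousAt
  obtain ⟨M, hM⟩ := isCompact_univ.exists_bound_of_continuousOn hinv.continuousOn
  refine ⟨_, hinv, fun x y => ?_, fun x y => ?_, max M 0, le_max_right _ _, fun x y => ?_⟩
  · exact congrArg (fun T : Y →L[ℂ] Y => T y) (Ring.mul_inverse_cancel _ (hU x))
  · exact congrArg (fun T : Y →L[ℂ] Y => T y) (Ring.inverse_mul_cancel _ (hU x))
  · refine (ContinuousLinearMap.le_opNorm _ _).trans ?_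
    gcongr
    exact (hM x trivial).trans (le_max_left _ _)

/-- If all truncated convolution equations `f + ∫_0^a f(ξ) H(ξ - ·) dξ = g` are uniquely solvable
in `C([0,1])`, then the solutions are bounded in terms of `g`, uniformly in `a`. -/
theorem exists_bound_of_isUnit {H : ℝ → A} (hH : MemLp H 2 volume)
    (hU : ∀ a : I, IsUnit (1 + convOp (ContinuousLinearMap.mul ℂ A) hH a)) :
    ∃ M : ℝ, 0 ≤ M ∧ ∀ a ∈ Icc (0 : ℝ) 1, ∀ f g : ℝ → A, ContinuousOn f (Icc 0 1) →
      ContinuousOn g (Icc 0 1) → ∀ m : ℝ,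
      (∀ t ∈ Icc (0 : ℝ) 1, f t + ∫ ξ in (0 : ℝ)..a, f ξ * H (ξ - t) = g t) →
      (∀ t ∈ Icc (0 : ℝ) 1, ‖g t‖ ≤ m) → ∀ t ∈ Icc (0 : ℝ) 1, ‖f t‖ ≤ M * m := by
  obtain ⟨S, -, -, hS, M, hM0, hM⟩ := exists_solution_operator (continuous_convOp _ hH) hU
  refine ⟨M, hM0, fun a ha f g hf hg m hfg hgm t ht => ?_⟩
  have hm : 0 ≤ m := (norm_nonneg _).trans (hgm t ht)
  let f' : C(I, A) := ⟨fun x => f x, continuousOn_iff_continuous_domRestrict.1 hf⟩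
  let g' : C(I, A) := ⟨fun x => g x, continuousOn_iff_continuous_domRestrict.1 hg⟩
  have hTf : f' + convOp (ContinuousLinearMap.mul ℂ A) hH ⟨a, ha⟩ f' = g' := by
    ext x
    change f x + convOp _ hH ⟨a, ha⟩ f' x = g x
    rw [← hfg x x.2, convOp_apply]
    congr 1
    refine intervalIntegral.integral_congr fun ξ hξ => ?_
    rw [uIcc_of_le ha.1] at hξ
    have : lineExtend f' ξ = f ξ := lineExtend_of_mem f' ⟨hξ.1, hξ.2.trans ha.2⟩
    simp [this]
  calc ‖f t‖ = ‖f' ⟨t, ht⟩‖ := rfl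
    _ ≤ ‖f'‖ := f'.norm_coe_le_norm _
    _ = ‖S ⟨a, ha⟩ g'‖ := by rw [← hTf, hS]
    _ ≤ M * ‖g'‖ := hM _ _
    _ ≤ M * m := by
        gcongr
        exact (ContinuousMap.norm_le _ hm).2 fun x => hgm x x.2

/-- Splitting off `-H(x-ξ)` leaves an equation with the continuous right-hand side `-∫_0^x
H(x-ξ)H(ξ-t) dξ`; apply the continuous family of inverses to it. -/
theorem exists_continuous_krein_unitInterval {H : ℝ → A} (hH : MemLp H 2 volume)
    (hU : ∀ a : I, IsUnit (1 + convOp (ContinuousLinearMap.mul ℂ A) hH a)) :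
    ∃ c : I → C(I, A), Continuous c ∧ ∀ x t : I,
      c x t = ∫ ξ in (0 : ℝ)..x, (-H (x - ξ) - lineExtend (c x) ξ) * H (ξ - t) := by
  obtain ⟨S, hS, hS', -⟩ := exists_solution_operator (continuous_convOp _ hH) hU
  have hk : Continuous fun p : I × I => ∫ ξ in (0 : ℝ)..p.1, H (p.1 - ξ) * H (ξ - p.2) :=
    ((l2Continuous_reflect hH).comp (by fun_prop : Continuous fun p : I × I => (p.1 : ℝ)))
      |>.intervalIntegral_mul ((l2Continuous_translate hH).comp (by fun_prop))
      continuous_const (by fun_prop)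
  let k : C(I, C(I, A)) := ContinuousMap.curry ⟨_, hk⟩
  refine ⟨fun x => S x (-k x), hS.clm_apply k.continuous.neg, fun x t => ?_⟩
  have h1 := congrArg (fun f : C(I, A) => f t) (hS' x (-k x))
  set c := S x (-k x)
  have i1 : IntervalIntegrable (fun ξ => H (x - ξ) * H (ξ - t)) volume 0 x :=
    (integrable_bilin_of_memLp (ContinuousLinearMap.mul ℂ A) ((l2Continuous_reflect hH).1 x)
      (memLp_translate hH t)).intervalIntegrable
  have e1 := intervalIntegral.integral_sub i1.neg
    (intervalIntegrable_mul_translate hH (continuous_lineExtend c) t 0 x)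
  simp only [sub_mul, neg_mul]
  refine Eq.trans ?_ e1.symm
  simp only [Pi.neg_apply, intervalIntegral.integral_neg]
  exact eq_sub_of_add_eq h1

/-- The Krein equation in the form `C(x,t) = ∫_0^x R(x,ξ) H(ξ-t) dξ` with
`R(x,ξ) = -H(x-ξ) - C(x,ξ)` has a jointly continuous solution `C`. -/
theorem exists_continuous_krein {H : ℝ → A} (hH : MemLp H 2 volume)
    (hU : ∀ a : I, IsUnit (1 + convOp (ContinuousLinearMap.mul ℂ A) hH a)) :
    ∃ C : ℝ → ℝ → A, Continuous (Function.uncurry C) ∧ ∀ x ∈ Icc (0 : ℝ) 1, ∀ t,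
      C x t = ∫ ξ in (0 : ℝ)..x, (-H (x - ξ) - C x ξ) * H (ξ - t) := by
  obtain ⟨c, hc, hcx⟩ := exists_continuous_krein_unitInterval hH hU
  have hP : Continuous (projIcc (0 : ℝ) 1 zero_le_one) := continuous_projIcc
  have hc' : Continuous (Function.uncurry fun (p : ℝ × ℝ) ξ =>
      lineExtend (c (projIcc 0 1 zero_le_one p.1)) ξ) := by
    have h1 : Continuous fun q : I × I => c q.1 q.2 :=
      ContinuousMap.continuous_uncurry_of_continuous ⟨c, hc⟩
    exact h1.comp (by fun_prop : Continuous fun q : (ℝ × ℝ) × ℝ =>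
      (projIcc (0 : ℝ) 1 zero_le_one q.1.1, projIcc (0 : ℝ) 1 zero_le_one q.2))
  have hcont := (((l2Continuous_reflect hH).comp
    (by fun_prop : Continuous fun p : ℝ × ℝ => (projIcc (0 : ℝ) 1 zero_le_one p.1 : ℝ))).neg.sub
      (l2Continuous_indicator_of_continuous hc' 0 1)).intervalIntegral_mul
      ((l2Continuous_translate hH).comp continuous_snd) (continuous_const (y := 0))
      (by fun_prop : Continuous fun p : ℝ × ℝ => (projIcc (0 : ℝ) 1 zero_le_one p.1 : ℝ))
  have hval : ∀ x (hx : x ∈ Icc (0 : ℝ) 1) (t : ℝ), (∫ ξ in (0 : ℝ)..projIcc 0 1 zero_le_one x,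
      (-H (projIcc 0 1 zero_le_one x - ξ) - (Ioc 0 1).indicator
        (fun ξ => lineExtend (c (projIcc 0 1 zero_le_one x)) ξ) ξ) * H (ξ - t)) =
      ∫ ξ in (0 : ℝ)..x, (-H (x - ξ) - lineExtend (c ⟨x, hx⟩) ξ) * H (ξ - t) := by
    intro x hx t
    rw [projIcc_of_mem _ hx]
    refine intervalIntegral.integral_congr_ae (Eventually.of_forall fun ξ hξ => ?_)
    rw [uIoc_of_le hx.1] at hξ
    have hξ' : ξ ∈ Ioc (0 : ℝ) 1 := ⟨hξ.1, hξ.2.trans hx.2⟩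
    rw [indicator_of_mem hξ']
  -- The extension to the plane is the right-hand side of the equation itself, with `x` clamped to
  -- `[0,1]`. It agrees with `c` on the square, so the equation holds for every real `t`; later it
  -- is used at `t = x - u` with arbitrary `u`.
  refine ⟨fun x t => ∫ ξ in (0 : ℝ)..projIcc 0 1 zero_le_one x,
      (-H (projIcc 0 1 zero_le_one x - ξ) - (Ioc 0 1).indicator
        (fun ξ => lineExtend (c (projIcc 0 1 zero_le_one x)) ξ) ξ) * H (ξ - t), hcont, fun x hx t => (hval x hx t).trans ?_⟩
  refine intervalIntegral.integral_congr fun ξ hξ => ?_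
  rw [uIcc_of_le hx.1] at hξ
  have hξ' : ξ ∈ Icc (0 : ℝ) 1 := ⟨hξ.1, hξ.2.trans hx.2⟩
  have h2 := (hcx ⟨x, hx⟩ ⟨ξ, hξ'⟩).trans (hval x hx ξ).symm
  rw [lineExtend_of_mem _ hξ', h2]

end Resolvent

/-! ### Invertibility from the accelerant condition -/

section Accelerant

open scoped ENNReal unitInterval ComplexOrder

variable {r : ℕ} {H : ℝ → Mr r}

theorem lineExtend_eq_zero_iff {A : Type*} [NormedRing A] {f : C(I, A)}
    (h : ∀ᵐ x ∂mu01, lineExtend f x = 0) : f = 0 := by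
  have h1 : lineExtend f =ᵐ[volume.restrict (Icc 0 1)] fun _ => 0 := by
    rw [← Measure.restrict_congr_set Ioo_ae_eq_Icc]
    exact h
  have h2 := Measure.eqOn_Icc_of_ae_eq volume zero_ne_one h1
    (continuous_lineExtend f).continuousOn continuousOn_const
  ext x
  rw [← lineExtend_of_mem f x.2]
  exact h2 x.2

/-- Applied to a fixed vector, a matrix solution becomes a vector solution of the accelerant
equation, after evenness turns `H(ξ-t)` into `H(t-ξ)`. Basis vectors recover the columns. -/
theorem eq_zero_of_left_convolution (hH : MemLp H 2 volume)
    (hacc : IsAccelerant H) (heven : ∀ x, H (-x) = H x) (a : I) (f : C(I, Mr r))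
    (hf : f + convOp (ContinuousLinearMap.mul ℂ (Mr r)).flip hH a f = 0) : f = 0 := by
  let Φ : EuclideanSpace ℂ (Fin r) → (Mr r →L[ℂ] EuclideanSpace ℂ (Fin r)) := fun v =>
    LinearMap.toContinuousLinearMap
      { toFun := fun M => Matrix.toEuclideanCLM (𝕜 := ℂ) M v
        map_add' := fun M N => by simp
        map_smul' := fun c M => by simp }
  have key : ∀ v, ∀ᵐ x ∂mu01, Φ v (lineExtend f x) = 0 := fun v => by
    have hc : Continuous fun x => Φ v (lineExtend f x) :=
      (Φ v).continuous.comp (continuous_lineExtend f)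
    refine hacc.trivial_ker a a.2 _ ((hc.memLp_restrict_Icc 0 1).mono_measure
      (Measure.restrict_mono Ioo_subset_Icc_self le_rfl)) ?_
    refine ae_restrict_of_forall_mem measurableSet_Ioo fun x hx => ?_
    have hx' := Ioo_subset_Icc_self hx
    have h1 := congrArg (fun g : C(I, Mr r) => Φ v (g ⟨x, hx'⟩)) hf
    simp only [ContinuousMap.add_apply, convOp_apply, map_add, ContinuousMap.zero_apply,
      map_zero] at h1
    rw [← (Φ v).intervalIntegral_comp_comm
      (intervalIntegrable_bilin_translate _ hH (continuous_lineExtend f) _ _ _)] at h1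
    rw [lineExtend_of_mem f hx', ← h1]
    congr 1
    refine intervalIntegral.integral_congr fun t _ => ?_
    simp only [Φ, LinearMap.coe_toContinuousLinearMap', LinearMap.coe_mk, AddHom.coe_mk,
      ContinuousLinearMap.flip_apply, ContinuousLinearMap.mul_apply', map_mul,
      mul_apply_eq_comp]
    rw [← heven (x - t), neg_sub]
  refine lineExtend_eq_zero_iff ?_
  have h2 := ae_all_iff.2 fun i : Fin r => key (EuclideanSpace.single i 1)
  filter_upwards [h2] with x hx
  ext i j
  have := congrArg (fun w : EuclideanSpace ℂ (Fin r) => w i) (hx j)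
  simpa [Φ, Matrix.ofLp_toEuclideanCLM] using this

/-- Duality between left and right multiplication; no self-adjointness of `H` is involved. The left
equation is already known to be solvable, so solve it with right-hand side `g*` and pair the
solution with `g`. -/
theorem eq_zero_of_right_convolution (hH : MemLp H 2 volume)
    (hacc : IsAccelerant H) (heven : ∀ x, H (-x) = H x) (a : I) (g : C(I, Mr r))
    (hg : g + convOp (ContinuousLinearMap.mul ℂ (Mr r)) hH a g = 0) : g = 0 := by
  have hP : ProperSpace (Mr r) := FiniteDimensional.proper ℂ _
  have hgt : ∀ t : I, g t + ∫ ξ in (0 : ℝ)..a, lineExtend g ξ * H (ξ - t) = 0 := fun t =>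
    congrArg (fun f : C(I, Mr r) => f t) hg
  -- The integral sees `g` only on `(0,a]`; if `g` vanishes there, the equation gives `g = 0`
  -- everywhere.
  suffices hz : ∀ ξ ∈ Ioc (0 : ℝ) a, lineExtend g ξ = 0 by
    ext1 t
    rw [← add_zero (g t)]
    refine Eq.trans ?_ (hgt t)
    congr 1
    symm
    refine intervalIntegral.integral_zero_ae (Eventually.of_forall fun ξ hξ => ?_)
    rw [uIoc_of_le a.2.1] at hξ
    simp [hz ξ hξ]
  obtain ⟨f, hf⟩ := ((ContinuousLinearMap.isUnit_iff_bijective).1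
    (isUnit_one_add_convOp _ hH a (eq_zero_of_left_convolution hH hacc heven a))).2 (star g)
  have hft : ∀ t : I, f t + ∫ ξ in (0 : ℝ)..a, H (ξ - t) * lineExtend f ξ = star (g t) := fun t =>
    congrArg (fun f : C(I, Mr r) => f t) hf
  have hgc := continuous_lineExtend g
  have hfc := continuous_lineExtend f
  -- With `H·f` and `g·H` the two convolutions over `(0,a]`: `∫ g g* = ∫ g (f + H·f) = ∫ (g + g·H) f
  -- = 0`, by Fubini and evenness. Taking the trace of `g g* ≥ 0` below then gives `g = 0`.
  have h1 : ∫ t in (0 : ℝ)..a, lineExtend g t * star (lineExtend g t) = 0 := by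
    have hL2 : ∀ f : C(I, Mr r), MemLp (lineExtend f) 2 (volume.restrict (Ioc 0 (a : ℝ))) :=
      fun f => memLp_lineExtend f 0 a
    have hint := integrable_mul_mul_prod (hL2 g) ((memLp_two_sub_prod hH
      (volume.restrict (Ioc 0 (a : ℝ)))).mono_measure (Measure.prod_mono
      (μ := volume.restrict (Ioc 0 (a : ℝ))) Measure.restrict_le_self le_rfl)) (hL2 f)
    have i1 : Integrable (fun t => lineExtend g t * lineExtend f t)
        (volume.restrict (Ioc 0 (a : ℝ))) := (hL2 g).integrable_mul (hL2 f)
    simp only [intervalIntegral.integral_of_le a.2.1] at hft hgt ⊢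
    have e1 : ∀ t ∈ Ioc (0 : ℝ) a, lineExtend g t * star (lineExtend g t) =
        lineExtend g t * lineExtend f t +
          ∫ ξ in Ioc (0 : ℝ) a, lineExtend g t * H (t - ξ) * lineExtend f ξ := fun t ht => by
      have ht' : t ∈ Icc (0 : ℝ) 1 := ⟨ht.1.le, ht.2.trans a.2.2⟩
      simp only [mul_assoc]
      rw [integral_const_mul_of_integrable, ← mul_add, lineExtend_of_mem g ht', ← hft ⟨t, ht'⟩,
        lineExtend_of_mem f ht']
      · congr 2
        refine integral_congr_ae (Eventually.of_forall fun ξ => ?_)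
        simp only [← heven (t - ξ), neg_sub]
      · exact ((l2Continuous_reflect hH).1 t).restrict _ |>.integrable_mul (hL2 f)
    have e2 : ∀ ξ ∈ Ioc (0 : ℝ) a, lineExtend g ξ * lineExtend f ξ +
        ∫ t in Ioc (0 : ℝ) a, lineExtend g t * H (t - ξ) * lineExtend f ξ = 0 := fun ξ hξ => by
      have hξ' : ξ ∈ Icc (0 : ℝ) 1 := ⟨hξ.1.le, hξ.2.trans a.2.2⟩
      rw [integral_mul_const_of_integrable, ← add_mul, lineExtend_of_mem g hξ', hgt ⟨ξ, hξ'⟩,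
        zero_mul]
      exact (hL2 g).integrable_mul ((memLp_translate hH ξ).restrict _)
    rw [setIntegral_congr_fun measurableSet_Ioc e1, integral_add i1 hint.integral_prod_left,
      integral_integral_swap hint, ← integral_add i1 hint.integral_prod_right,
      setIntegral_congr_fun measurableSet_Ioc e2, integral_zero]
  have hgs : Continuous fun t => lineExtend g t * star (lineExtend g t) := by fun_prop
  let Ψ : Mr r →L[ℝ] ℝ := Complex.reCLM ∘L
    ((LinearMap.toContinuousLinearMap (Matrix.traceLinearMap (Fin r) ℂ ℂ)).restrictScalars ℝ)
  have hΨ0 : ∀ t, 0 ≤ Ψ (lineExtend g t * star (lineExtend g t)) := fun t =>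
    (Complex.le_def.1 (Matrix.posSemidef_self_mul_conjTranspose (lineExtend g t)).trace_nonneg).1
  have hΨ : ∫ t in (0 : ℝ)..a, Ψ (lineExtend g t * star (lineExtend g t)) = 0 := by
    rw [Ψ.intervalIntegral_comp_comm (hgs.intervalIntegrable _ _), h1, map_zero]
  intro ξ hξ
  have ha : (0 : ℝ) < a := hξ.1.trans_le hξ.2
  have hz : Ψ (lineExtend g ξ * star (lineExtend g ξ)) = 0 := by
    have hc : Continuous fun t => Ψ (lineExtend g t * star (lineExtend g t)) :=
      Ψ.continuous.comp hgs
    by_contra hne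
    exact absurd hΨ (intervalIntegral.integral_pos ha hc.continuousOn (fun t _ => hΨ0 t)
      ⟨ξ, Ioc_subset_Icc_self hξ, lt_of_le_of_ne (hΨ0 ξ) (Ne.symm hne)⟩).ne'
  have htr : Matrix.trace (lineExtend g ξ * star (lineExtend g ξ)) = 0 := by
    have h3 := Complex.le_def.1
      (Matrix.posSemidef_self_mul_conjTranspose (lineExtend g ξ)).trace_nonneg
    exact Complex.ext hz h3.2.symm
  exact Matrix.trace_mul_conjTranspose_self_eq_zero_iff.1 htr

theorem isUnit_one_add_convOp_mul (hH : MemLp H 2 volume)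
    (hacc : IsAccelerant H) (heven : ∀ x, H (-x) = H x) (a : I) :
    IsUnit (1 + convOp (ContinuousLinearMap.mul ℂ (Mr r)) hH a) :=
  have : ProperSpace (Mr r) := FiniteDimensional.proper ℂ _
  isUnit_one_add_convOp _ hH a (eq_zero_of_right_convolution hH hacc heven a)

end Accelerant

/-! ### A quadratic Gronwall lemma -/

section Gronwall

/-- The primitive `F(x) = ∫_0^x f²` satisfies `F' ≤ K² F` and `F(0) = 0`, so `F = 0`. -/
theorem eq_zero_of_le_sqrt_integral_sq {f : ℝ → ℝ} {K : ℝ} (hf : ContinuousOn f (Icc 0 1))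
    (h0 : ∀ x ∈ Icc (0 : ℝ) 1, 0 ≤ f x)
    (h : ∀ x ∈ Icc (0 : ℝ) 1, f x ≤ K * √(∫ t in (0 : ℝ)..x, f t ^ 2)) :
    ∀ x ∈ Icc (0 : ℝ) 1, f x = 0 := by
  set g : ℝ → ℝ := IccExtend (zero_le_one' ℝ) (domRestrict (Icc 0 1) f) with hg
  have hgc : Continuous g := (continuousOn_iff_continuous_domRestrict.1 hf).Icc_extend'
  have hgf : ∀ x ∈ Icc (0 : ℝ) 1, g x = f x := fun x hx => IccExtend_of_mem _ _ hx
  have hF : ∀ x ∈ Icc (0 : ℝ) 1, ∫ t in (0 : ℝ)..x, g t ^ 2 = 0 := by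
    refine eq_zero_of_abs_deriv_le_mul_abs_self_of_eq_zero_right (f' := fun x => g x ^ 2)
      (K := K ^ 2) ?_ (fun x _ => ?_) (by simp) fun x hx => ?_
    · exact (intervalIntegral.continuous_primitive
        (fun a b => (hgc.pow 2).intervalIntegrable a b) 0).continuousOn
    · exact ((hgc.pow 2).integral_hasStrictDerivAt 0 x).hasDerivAt.hasDerivWithinAt
    · have hx' := Ico_subset_Icc_self hx
      have hnn : 0 ≤ ∫ t in (0 : ℝ)..x, g t ^ 2 :=
        intervalIntegral.integral_nonneg hx.1 fun t _ => sq_nonneg _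
      have e : ∫ t in (0 : ℝ)..x, f t ^ 2 = ∫ t in (0 : ℝ)..x, g t ^ 2 := by
        refine intervalIntegral.integral_congr fun t ht => ?_
        rw [uIcc_of_le hx.1] at ht
        simp only [hgf t ⟨ht.1, ht.2.trans hx'.2⟩]
      have h1 := h x hx'
      rw [e] at h1
      rw [Real.norm_of_nonneg (sq_nonneg _), Real.norm_of_nonneg hnn, hgf x hx']
      calc f x ^ 2 ≤ (K * √(∫ t in (0 : ℝ)..x, g t ^ 2)) ^ 2 := by
            gcongr
            exact h0 x hx'
        _ = _ := by rw [mul_pow, Real.sq_sqrt hnn]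
  intro x hx
  have h1 := h x hx
  have e : ∫ t in (0 : ℝ)..x, f t ^ 2 = ∫ t in (0 : ℝ)..x, g t ^ 2 := by
    refine intervalIntegral.integral_congr fun t ht => ?_
    rw [uIcc_of_le hx.1] at ht
    simp only [hgf t ⟨ht.1, ht.2.trans hx.2⟩]
  rw [e, hF x hx, Real.sqrt_zero, mul_zero] at h1
  exact le_antisymm h1 (h0 x hx)

end Gronwall

/-! ### The Bellman–Krein identity -/

section BellmanKrein

open scoped ENNReal unitInterval

theorem integral_triangle_swap {E : Type*} [NormedAddCommGroup E] [NormedSpace ℝ E]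
    {Φ : ℝ → ℝ → E} {x : ℝ} (hx : 0 ≤ x) (hΦ : Integrable (fun p : ℝ × ℝ => Φ p.1 p.2)
      ((volume.restrict (Ioc 0 x)).prod (volume.restrict (Ioc 0 x)))) :
    ∫ v in (0 : ℝ)..x, ∫ y in v..x, Φ y v = ∫ y in (0 : ℝ)..x, ∫ v in (0 : ℝ)..y, Φ y v := by
  have hS : MeasurableSet {p : ℝ × ℝ | p.2 ≤ p.1} := measurableSet_le measurable_snd measurable_fst
  have h1 := integral_integral_swap (f := fun y v => ({p : ℝ × ℝ | p.2 ≤ p.1}).indicator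
    (fun p => Φ p.1 p.2) (y, v)) (hΦ.indicator hS)
  rw [intervalIntegral.integral_of_le hx, intervalIntegral.integral_of_le hx]
  refine Eq.trans ?_ (h1.symm.trans ?_)
  · refine setIntegral_congr_fun measurableSet_Ioc fun v hv => ?_
    rw [intervalIntegral.integral_of_le hv.2, ← integral_Icc_eq_integral_Ioc]
    have : (fun y => ({p : ℝ × ℝ | p.2 ≤ p.1}).indicator (fun p => Φ p.1 p.2) (y, v)) =
        (Ici v).indicator fun y => Φ y v := by
      ext y
      simp [indicator]
    rw [this, setIntegral_indicator measurableSet_Ici]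
    congr 2
    ext y
    simp only [mem_Icc, mem_inter_iff, mem_Ioc, mem_Ici]
    exact ⟨fun h => ⟨⟨hv.1.trans_le h.1, h.2⟩, h.1⟩, fun h => ⟨h.2, h.1.2⟩⟩
  · refine setIntegral_congr_fun measurableSet_Ioc fun y hy => ?_
    rw [intervalIntegral.integral_of_le hy.1.le]
    have : (fun v => ({p : ℝ × ℝ | p.2 ≤ p.1}).indicator (fun p => Φ p.1 p.2) (y, v)) =
        (Iic y).indicator fun v => Φ y v := by
      ext v
      simp [indicator]
    rw [this, setIntegral_indicator measurableSet_Iic]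
    congr 2
    ext v
    simp only [mem_inter_iff, mem_Ioc, mem_Iic]
    exact ⟨fun h => ⟨h.1.1, h.2⟩, fun h => ⟨⟨h.1, h.2.trans hy.2⟩, h.2⟩⟩

variable {A : Type*} [NormedRing A]

/-- An even square-integrable `H` together with a jointly continuous `C` such that
`R(x,ξ) = -H(x-ξ) - C(x,ξ)` solves the Krein equation of `H`. -/
structure IsKreinPair [NormedAlgebra ℂ A] (H : ℝ → A) (C : ℝ → ℝ → A) : Prop where
  memLp : MemLp H 2 volume
  even : ∀ x, H (-x) = H x
  continuous : Continuous (Function.uncurry C)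
  eqn : ∀ x ∈ Icc (0 : ℝ) 1, ∀ t, C x t = ∫ ξ in (0 : ℝ)..x, (-H (x - ξ) - C x ξ) * H (ξ - t)

/-- The solution `R` of the Krein equation, cut off at `x = 1`. -/
noncomputable def kreinKernel (H : ℝ → A) (C : ℝ → ℝ → A) (x ξ : ℝ) : A :=
  -H (x - ξ) - (Ioc 0 1).indicator (fun x => C x ξ) x

/-- The potential `τ(x) = -R(x,0)`. -/
noncomputable def kreinPotential (H : ℝ → A) (C : ℝ → ℝ → A) (x : ℝ) : A := -kreinKernel H C x 0

theorem kreinKernel_of_mem (H : ℝ → A) (C : ℝ → ℝ → A) {x : ℝ} (hx : x ∈ Ioc (0 : ℝ) 1) (ξ : ℝ) :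
    kreinKernel H C x ξ = -H (x - ξ) - C x ξ := by
  simp [kreinKernel, hx]

variable [NormedAlgebra ℂ A]

namespace IsKreinPair

variable {H : ℝ → A} {C : ℝ → ℝ → A} (hC : IsKreinPair H C)
include hC

theorem continuous_left (x : ℝ) : Continuous (C x) :=
  hC.continuous.comp (by fun_prop : Continuous fun t => (x, t))

theorem continuous_right (t : ℝ) : Continuous fun x => C x t :=
  hC.continuous.comp (by fun_prop : Continuous fun x => (x, t))

/-- The cut-off of `C` in the first variable is what puts `y ↦ R(y,u)` into L² of the whole line. -/
theorem l2Continuous_kernel : L2Continuous fun u y => kreinKernel H C y u :=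
  (l2Continuous_translate hC.memLp).neg.sub (l2Continuous_indicator_of_continuous
    (c := fun u y => C y u) (hC.continuous.comp continuous_swap) 0 1)

theorem memLp_potential : MemLp (kreinPotential H C) 2 volume :=
  (hC.l2Continuous_kernel.1 0).neg

theorem memLp_kernel_left (x a b : ℝ) :
    MemLp (kreinKernel H C x) 2 (volume.restrict (Ioc a b)) := by
  by_cases hx : x ∈ Ioc (0 : ℝ) 1
  · have : kreinKernel H C x = fun ξ => -H (x - ξ) - C x ξ :=
      funext fun ξ => kreinKernel_of_mem H C hx ξ
    rw [this]
    exact (((l2Continuous_reflect hC.memLp).1 x).restrict _).neg.sub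
      (((hC.continuous_left x).memLp_restrict_Icc a b).mono_measure
        (Measure.restrict_mono Ioc_subset_Icc_self le_rfl))
  · have : kreinKernel H C x = fun ξ => -H (x - ξ) := funext fun ξ => by simp [kreinKernel, hx]
    rw [this]
    exact (((l2Continuous_reflect hC.memLp).1 x).restrict _).neg

theorem memLp_kernel_prod (a b c d : ℝ) : MemLp (fun p : ℝ × ℝ => kreinKernel H C p.1 p.2) 2
    ((volume.restrict (Ioc a b)).prod (volume.restrict (Ioc c d))) := by
  have h1 : MemLp (fun p : ℝ × ℝ => H (p.1 - p.2)) 2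
      ((volume.restrict (Ioc a b)).prod (volume.restrict (Ioc c d))) :=
    (memLp_two_sub_prod hC.memLp (volume.restrict (Ioc c d))).mono_measure
      (Measure.prod_mono (μ := volume.restrict (Ioc a b)) Measure.restrict_le_self le_rfl)
  have h2 : MemLp (fun p : ℝ × ℝ => C p.1 p.2) 2
      ((volume.restrict (Ioc a b)).prod (volume.restrict (Ioc c d))) := by
    obtain ⟨K, hK⟩ := (isCompact_Icc (a := a) (b := b)).prod (isCompact_Icc (a := c) (b := d))
      |>.exists_bound_of_continuousOn (f := Function.uncurry C) hC.continuous.continuousOn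
    have hm : AEStronglyMeasurable (Function.uncurry C)
      ((volume.restrict (Ioc a b)).prod (volume.restrict (Ioc c d))) :=
      hC.continuous.aestronglyMeasurable
    refine MemLp.of_bound hm K ?_
    rw [Measure.prod_restrict]
    exact ae_restrict_of_forall_mem (measurableSet_Ioc.prod measurableSet_Ioc)
      fun p hp => hK p (prod_mono Ioc_subset_Icc_self Ioc_subset_Icc_self hp)
  have h3 := h2.indicator (s := Prod.fst ⁻¹' Ioc 0 1) (measurable_fst measurableSet_Ioc)
  exact h1.neg.sub h3

/-- Fubini's theorem on the triangle for products with the Krein kernel. -/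
theorem integral_integral_kernel_mul {k : ℝ → A} {x : ℝ} (hx : 0 ≤ x)
    (hk : MemLp k 2 (volume.restrict (Ioc 0 x))) :
    ∫ v in (0 : ℝ)..x, (∫ y in v..x, kreinPotential H C y * kreinKernel H C y v) * k v =
      ∫ y in (0 : ℝ)..x, kreinPotential H C y * ∫ v in (0 : ℝ)..y, kreinKernel H C y v * k v := by
  have hint := integrable_mul_mul_prod (hC.memLp_potential.restrict (Ioc 0 x))
    (hC.memLp_kernel_prod 0 x 0 x) hk
  have h1 := integral_triangle_swap (Φ := fun y v =>
    kreinPotential H C y * kreinKernel H C y v * k v) hx hint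
  refine Eq.trans ?_ (h1.trans ?_)
  · refine intervalIntegral.integral_congr fun v hv => ?_
    rw [uIcc_of_le hx] at hv
    simp only [intervalIntegral.integral_of_le hv.2]
    exact (integral_mul_const_of_integrable ((hC.memLp_potential.restrict _).integrable_mul
      ((hC.l2Continuous_kernel.1 v).restrict _))).symm
  · refine intervalIntegral.integral_congr fun y hy => ?_
    rw [uIcc_of_le hx] at hy
    simp only [intervalIntegral.integral_of_le hy.1, mul_assoc]
    exact integral_const_mul_of_integrable ((hC.memLp_kernel_left y 0 y).integrable_mul
      (hk.mono_measure (Measure.restrict_mono (Ioc_subset_Ioc_right hy.2) le_rfl)))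

variable [CompleteSpace A]

theorem continuous_integral_potential_mul_kernel {X : Type*} [TopologicalSpace X]
    [FirstCountableTopology X] {a b u : X → ℝ} (ha : Continuous a) (hb : Continuous b)
    (hu : Continuous u) :
    Continuous fun p => ∫ y in a p..b p, kreinPotential H C y * kreinKernel H C y (u p) :=
  (l2Continuous_const hC.memLp_potential).intervalIntegral_mul (hC.l2Continuous_kernel.comp hu)
    ha hb

/-- Reflecting `v ↦ x - v` in the first term and applying the Krein equation gives `-C(x,x-u) - ∫
H(v)H(v-u)`; Fubini and the Krein equation turn the double integral into `∫ τ(y)C(y,u)`. What is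
left recombines through `τ = H + C(·,0)` and `R = -H - C`. Adding the defect at `u` cancels all
dependence on `x`. -/
theorem integral_defect_mul {x : ℝ} (hx : x ∈ Icc (0 : ℝ) 1) (u : ℝ) :
    ∫ v in (0 : ℝ)..x, (C x (x - v) - C v 0 -
      ∫ y in v..x, kreinPotential H C y * kreinKernel H C y v) * H (v - u) =
      -C x (x - u) + ∫ y in (0 : ℝ)..x, kreinPotential H C y * kreinKernel H C y u := by
  have hH := hC.memLp
  have hcW := hC.continuous_integral_potential_mul_kernel continuous_id (continuous_const (y := x))
    continuous_id
  have i1 : IntervalIntegrable (fun v => C x (x - v) * H (v - u)) volume 0 x :=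
    intervalIntegrable_mul_translate hH ((hC.continuous_left x).comp (by fun_prop)) u 0 x
  have i2 := intervalIntegrable_mul_translate hH (hC.continuous_right 0) u 0 x
  have i3 : IntervalIntegrable (fun v => (∫ y in v..x, kreinPotential H C y *
      kreinKernel H C y v) * H (v - u)) volume 0 x := intervalIntegrable_mul_translate hH hcW u 0 x
  have iH : ∀ t, IntervalIntegrable (fun v => H v * H (v - t)) volume 0 x := fun t =>
    (hH.integrable_mul (memLp_translate hH t)).intervalIntegrable
  have e1 : ∫ v in (0 : ℝ)..x, C x (x - v) * H (v - u) =
      -C x (x - u) - ∫ v in (0 : ℝ)..x, H v * H (v - u) := by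
    have a1 : ∫ v in (0 : ℝ)..x, C x (x - v) * H (v - u) =
        ∫ ξ in (0 : ℝ)..x, C x ξ * H (ξ - (x - u)) := by
      have := intervalIntegral.integral_comp_sub_left (a := 0) (b := x)
        (fun ξ => C x ξ * H (ξ - (x - u))) x
      simp only [sub_self, sub_zero] at this
      rw [← this]
      refine intervalIntegral.integral_congr fun v _ => ?_
      rw [← hC.even (v - u)]
      congr 2
      ring
    have a2 : ∫ v in (0 : ℝ)..x, H v * H (v - u) =
        ∫ ξ in (0 : ℝ)..x, H (x - ξ) * H (ξ - (x - u)) := by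
      have := intervalIntegral.integral_comp_sub_left (a := 0) (b := x)
        (fun ξ => H (x - ξ) * H (ξ - (x - u))) x
      simp only [sub_self, sub_zero] at this
      rw [← this]
      refine intervalIntegral.integral_congr fun v _ => ?_
      rw [← hC.even (v - u)]
      congr 2 <;> ring
    have a3 := hC.eqn x hx (x - u)
    have j1 : IntervalIntegrable (fun ξ => H (x - ξ) * H (ξ - (x - u))) volume 0 x :=
      (((l2Continuous_reflect hH).1 x).integrable_mul
        (memLp_translate hH (x - u))).intervalIntegrable
    have a4 := intervalIntegral.integral_sub j1.neg
      (intervalIntegrable_mul_translate hH (hC.continuous_left x) (x - u) 0 x)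
    simp only [sub_mul, neg_mul] at a3
    rw [a1, a2, a3]
    refine Eq.trans ?_ (congrArg (fun z => -z - _) a4.symm)
    simp only [Pi.neg_apply, intervalIntegral.integral_neg]
    abel
  have e3 : ∫ v in (0 : ℝ)..x, (∫ y in v..x, kreinPotential H C y * kreinKernel H C y v) *
      H (v - u) = ∫ y in (0 : ℝ)..x, kreinPotential H C y * C y u := by
    rw [hC.integral_integral_kernel_mul hx.1 ((memLp_translate hH u).restrict _)]
    refine intervalIntegral.integral_congr_ae (Eventually.of_forall fun y hy => ?_)
    rw [uIoc_of_le hx.1] at hy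
    have hy' : y ∈ Ioc (0 : ℝ) 1 := ⟨hy.1, hy.2.trans hx.2⟩
    rw [hC.eqn y (Ioc_subset_Icc_self hy') u]
    simp only [kreinKernel_of_mem H C hy']
  have e4 : ∫ y in (0 : ℝ)..x, kreinPotential H C y * kreinKernel H C y u =
      -(∫ y in (0 : ℝ)..x, H y * H (y - u)) - (∫ y in (0 : ℝ)..x, C y 0 * H (y - u)) -
        ∫ y in (0 : ℝ)..x, kreinPotential H C y * C y u := by
    have j3 : IntervalIntegrable (fun y => kreinPotential H C y * C y u) volume 0 x := by
      rw [intervalIntegrable_iff_integrableOn_Ioc_of_le hx.1]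
      exact (hC.memLp_potential.restrict _).integrable_mul
        (((hC.continuous_right u).memLp_restrict_Icc 0 x (p := 2)).mono_measure
          (Measure.restrict_mono Ioc_subset_Icc_self le_rfl))
    have jH : IntervalIntegrable (fun v => -(H v * H (v - u))) volume 0 x := (iH u).neg
    rw [← intervalIntegral.integral_neg, ← intervalIntegral.integral_sub jH i2,
      ← intervalIntegral.integral_sub (jH.sub i2) j3]
    refine intervalIntegral.integral_congr_ae (Eventually.of_forall fun y hy => ?_)
    rw [uIoc_of_le hx.1] at hy
    have hy' : y ∈ Ioc (0 : ℝ) 1 := ⟨hy.1, hy.2.trans hx.2⟩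
    rw [kreinKernel_of_mem H C hy', mul_sub]
    congr 1
    rw [kreinPotential, kreinKernel_of_mem H C hy']
    simp only [sub_zero]
    noncomm_ring
  simp only [sub_mul]
  rw [intervalIntegral.integral_sub (i1.sub i2) i3, intervalIntegral.integral_sub i1 i2, e1, e3, e4]
  abel

/-- The Bellman–Krein identity `R(x, x-u) = R(u, 0) + ∫_u^x R(y, 0) R(y, u) dy`. -/
theorem bellman_krein (hU : ∀ a : I, IsUnit (1 + convOp (ContinuousLinearMap.mul ℂ A) hC.memLp a))
    {x u : ℝ} (hx : x ∈ Icc (0 : ℝ) 1) (hu : u ∈ Icc (0 : ℝ) 1) :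
    C x (x - u) = C u 0 + ∫ y in u..x, kreinPotential H C y * kreinKernel H C y u := by
  obtain ⟨M, hM0, hM⟩ := exists_bound_of_isUnit hC.memLp hU
  have hH := hC.memLp
  set W : ℝ → ℝ → A := fun x v => C x (x - v) - C v 0 -
    ∫ y in v..x, kreinPotential H C y * kreinKernel H C y v with hW
  set D : ℝ → A := fun u =>
    -C u 0 + ∫ y in (0 : ℝ)..u, kreinPotential H C y * kreinKernel H C y u with hD
  have hWc : ∀ x, Continuous (W x) := fun x =>
    (((hC.continuous_left x).comp (by fun_prop)).sub (hC.continuous_right 0)).sub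
      (hC.continuous_integral_potential_mul_kernel continuous_id continuous_const continuous_id)
  have hDc : Continuous D := (hC.continuous_right 0).neg.add
    (hC.continuous_integral_potential_mul_kernel continuous_const continuous_id continuous_id)
  -- The defect `W x` solves the equation truncated at `x`, with a right-hand side `D` common to all
  -- `x`.
  have hWD : ∀ x ∈ Icc (0 : ℝ) 1, ∀ u, W x u + ∫ v in (0 : ℝ)..x, W x v * H (v - u) = D u := by
    intro x hx u
    rw [hC.integral_defect_mul hx u]
    have ii : ∀ a b, IntervalIntegrable (fun y => kreinPotential H C y * kreinKernel H C y u)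
        volume a b := fun a b =>
      (hC.memLp_potential.integrable_mul (hC.l2Continuous_kernel.1 u)).intervalIntegrable
    simp only [hW, hD]
    rw [← intervalIntegral.integral_add_adjacent_intervals (ii 0 u) (ii u x)]
    abel
  -- For `D - W x` the right-hand side is a convolution of `D`, controlled by the L² norm of `D` on
  -- `(0,x)`. A bound on `W x` itself would involve only the sup norm of `D` and would not close.
  have hX : ∀ x ∈ Icc (0 : ℝ) 1, ∀ u, (D u - W x u) + ∫ v in (0 : ℝ)..x, (D v - W x v) * H (v - u) =
      ∫ v in (0 : ℝ)..x, D v * H (v - u) := by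
    intro x hx u
    simp only [sub_mul]
    rw [intervalIntegral.integral_sub (intervalIntegrable_mul_translate hH hDc u 0 x)
      (intervalIntegrable_mul_translate hH (hWc x) u 0 x)]
    nth_rewrite 1 [← hWD x hx u]
    abel
  have hbound : ∀ x ∈ Icc (0 : ℝ) 1, ∀ u ∈ Icc (0 : ℝ) 1, ‖D u - W x u‖ ≤
      M * (‖ContinuousLinearMap.mul ℂ A‖ * (√(∫ v in (0 : ℝ)..x, ‖D v‖ ^ 2) *
        (eLpNorm H 2 volume).toReal)) := fun x hx =>
    hM x hx _ _ (hDc.sub (hWc x)).continuousOn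
      (continuous_mul_convolution hH hDc 0 x).continuousOn _ (fun t _ => hX x hx t) fun t _ => by
        refine (norm_intervalIntegral_bilin_le (ContinuousLinearMap.mul ℂ A) hx.1
          ((hDc.memLp_restrict_Icc 0 x).mono_measure
            (Measure.restrict_mono Ioc_subset_Icc_self le_rfl)) (memLp_translate hH t)).trans ?_
        rw [eLpNorm_translate hH]
  -- At `u = x` the defect vanishes trivially, so `hbound` becomes a Gronwall inequality for `‖D‖`.
  have hD0 : ∀ x ∈ Icc (0 : ℝ) 1, ‖D x‖ = 0 := by
    refine eq_zero_of_le_sqrt_integral_sq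
      (K := M * (‖ContinuousLinearMap.mul ℂ A‖ * (eLpNorm H 2 volume).toReal))
      hDc.norm.continuousOn (fun _ _ => norm_nonneg _) fun x hx => ?_
    have h1 := hbound x hx x hx
    have h2 : W x x = 0 := by simp [hW]
    rw [h2, sub_zero] at h1
    refine h1.trans (le_of_eq (by ring))
  have h1 := hbound x hx u hu
  have h2 : ∫ v in (0 : ℝ)..x, ‖D v‖ ^ 2 = 0 := by
    refine intervalIntegral.integral_zero_ae (Eventually.of_forall fun v hv => ?_)
    rw [uIoc_of_le hx.1] at hv
    rw [hD0 v ⟨hv.1.le, hv.2.trans hx.2⟩, zero_pow two_ne_zero]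
  rw [h2, Real.sqrt_zero, zero_mul, mul_zero, mul_zero, norm_le_zero_iff, norm_eq_zero.1 (hD0 u hu),
    zero_sub, neg_eq_zero] at h1
  rw [← sub_eq_zero, ← sub_sub]
  exact h1

end IsKreinPair

end BellmanKrein

/-! ### The Krein system and its sine and cosine combinations -/

section DiracSystem

open Complex

/-- Integrated product rule with `g` merely integrable: Fubini on the triangle replaces
differentiation of the primitive. -/
theorem smul_integral_eq_integral {E : Type*} [NormedAddCommGroup E] [NormedSpace ℂ E]
    [CompleteSpace E] {c c' : ℝ → ℂ} (hc : ∀ x, HasDerivAt c (c' x) x) (hc' : Continuous c')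
    {g : ℝ → E} {x : ℝ} (hx : 0 ≤ x) (hg : IntervalIntegrable g volume 0 x) :
    c x • ∫ v in (0 : ℝ)..x, g v =
      ∫ y in (0 : ℝ)..x, (c' y • (∫ v in (0 : ℝ)..y, g v) + c y • g y) := by
  have hcc : Continuous c := continuous_iff_continuousAt.2 fun x => (hc x).continuousAt
  have hg' := (intervalIntegrable_iff_integrableOn_Ioc_of_le hx).1 hg
  have hint : Integrable (fun p : ℝ × ℝ => c' p.1 • g p.2)
      ((volume.restrict (Ioc 0 x)).prod (volume.restrict (Ioc 0 x))) :=
    Integrable.smul_prod (hc'.integrableOn_Ioc (a := 0) (b := x)) hg'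
  have h1 := integral_triangle_swap (Φ := fun y v => c' y • g v) hx hint
  have h2 : ∀ v, ∫ y in v..x, c' y • g v = c x • g v - c v • g v := fun v => by
    rw [intervalIntegral.integral_smul_const, intervalIntegral.integral_eq_sub_of_hasDerivAt
      (fun y _ => hc y) (hc'.intervalIntegrable _ _), sub_smul]
  simp only [h2, intervalIntegral.integral_smul] at h1
  have i1 : IntervalIntegrable (fun v => c v • g v) volume 0 x := by
    exact hg.continuousOn_smul hcc.continuousOn
  have i2 : IntervalIntegrable (fun y => c' y • ∫ v in (0 : ℝ)..y, g v) volume 0 x := by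
    refine ContinuousOn.intervalIntegrable (hc'.continuousOn.smul ?_)
    exact intervalIntegral.continuousOn_primitive_interval' hg left_mem_uIcc
  rw [intervalIntegral.integral_sub (hg.continuousOn_smul continuousOn_const) i1,
    intervalIntegral.integral_smul] at h1
  rw [intervalIntegral.integral_add i2 i1, ← h1]
  abel

variable {A : Type*} [NormedRing A] [NormedAlgebra ℂ A]

/-- `e^{-ilx}` times the exponential solution of the Krein system. -/
noncomputable def kreinP (H : ℝ → A) (C : ℝ → ℝ → A) (l : ℂ) (x : ℝ) : A :=
  1 - ∫ u in (0 : ℝ)..x, cexp (-(2 * I * l * u)) • (H u + C x (x - u))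

/-- The exponential solution of the Krein system. -/
noncomputable def kreinExp (H : ℝ → A) (C : ℝ → ℝ → A) (l : ℂ) (x : ℝ) : A :=
  cexp (I * l * x) • kreinP H C l x

variable {H : ℝ → A} {C : ℝ → ℝ → A}

/-- The representation of `kreinExp` by the Krein kernel. -/
theorem kreinExp_eq_integral_kernel (l : ℂ) {x : ℝ} (hx : x ∈ Ioc (0 : ℝ) 1) :
    kreinExp H C l x = cexp (I * l * x) • (1 : A) +
      ∫ s in (0 : ℝ)..x, cexp (I * l * (2 * s - x)) • kreinKernel H C x s := by
  have h1 := intervalIntegral.integral_comp_sub_left (a := 0) (b := x)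
        (fun s : ℝ => cexp (I * l * (2 * s - x)) • kreinKernel H C x s) x
  simp only [sub_self, sub_zero] at h1
  rw [kreinExp, kreinP, smul_sub, sub_eq_add_neg, ← h1, ← intervalIntegral.integral_smul,
    ← intervalIntegral.integral_neg]
  congr 1
  refine intervalIntegral.integral_congr fun u _ => ?_
  rw [kreinKernel_of_mem H C hx, smul_smul, ← Complex.exp_add, ← smul_neg]
  congr 2
  · push_cast
    ring
  · rw [sub_sub_cancel]
    abel

/-- Identifies the inner integral `∫_0^y R(y,s)e^{-2ils} ds`, which Fubini produces in `kreinP_eq`,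
in terms of the solution with parameter `-l`. -/
theorem exp_smul_kreinP_neg (l : ℂ) {y : ℝ} (hy : y ∈ Ioc (0 : ℝ) 1) :
    cexp (-(2 * I * l * y)) • kreinP H C (-l) y = cexp (-(2 * I * l * y)) • (1 : A) +
      ∫ s in (0 : ℝ)..y, kreinKernel H C y s * (cexp (-(2 * I * l * s)) • (1 : A)) := by
  have h1 := intervalIntegral.integral_comp_sub_left (a := 0) (b := y)
        (fun s : ℝ => kreinKernel H C y s * (cexp (-(2 * I * l * s)) • (1 : A))) y
  simp only [sub_self, sub_zero] at h1
  rw [kreinP, smul_sub, sub_eq_add_neg, ← h1, ← intervalIntegral.integral_smul,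
    ← intervalIntegral.integral_neg]
  congr 1
  refine intervalIntegral.integral_congr fun u _ => ?_
  rw [kreinKernel_of_mem H C hy, smul_smul, ← Complex.exp_add, ← smul_neg, mul_smul_comm, mul_one]
  congr 2
  · push_cast
    ring
  · rw [sub_sub_cancel]
    abel

namespace IsKreinPair

variable (hC : IsKreinPair H C)
include hC

theorem intervalIntegrable_H (a b : ℝ) : IntervalIntegrable H volume a b := by
  have : ∀ a b, IntegrableOn H (Ioc a b) volume := fun a b =>
    (hC.memLp.restrict (Ioc a b)).integrable (by norm_num)
  exact ⟨this a b, this b a⟩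

theorem intervalIntegrable_potential (a b : ℝ) :
    IntervalIntegrable (kreinPotential H C) volume a b := by
  have : ∀ a b, IntegrableOn (kreinPotential H C) (Ioc a b) volume := fun a b =>
    (hC.memLp_potential.restrict (Ioc a b)).integrable (by norm_num)
  exact ⟨this a b, this b a⟩

theorem intervalIntegrable_kernel (x a b : ℝ) :
    IntervalIntegrable (kreinKernel H C x) volume a b :=
  ⟨(hC.memLp_kernel_left x a b).integrable (by norm_num),
    (hC.memLp_kernel_left x b a).integrable (by norm_num)⟩

theorem intervalIntegrable_potential_mul {f : ℝ → A} (hf : Continuous f) (a b : ℝ) :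
    IntervalIntegrable (fun y => kreinPotential H C y * f y) volume a b :=
  (hC.intervalIntegrable_potential a b).mul_continuousOn hf.continuousOn

theorem continuous_kreinP (l : ℂ) : Continuous (kreinP H C l) := by
  have hcC : ∀ x, Continuous fun u : ℝ => cexp (-(2 * I * l * u)) • C x (x - u) := fun x =>
    (by fun_prop : Continuous fun u : ℝ => cexp (-(2 * I * l * u))).smul
      ((hC.continuous_left x).comp (by fun_prop))
  have hi : ∀ a b, IntervalIntegrable (fun u : ℝ => cexp (-(2 * I * l * u)) • H u) volume a b :=
    fun a b => (hC.intervalIntegrable_H a b).continuousOn_smul (by fun_prop)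
  have h1 : kreinP H C l = fun x => 1 - ((∫ u in (0 : ℝ)..x, cexp (-(2 * I * l * u)) • H u) +
      ∫ u in (0 : ℝ)..x, cexp (-(2 * I * l * u)) • C x (x - u)) := by
    ext1 x
    rw [kreinP, ← intervalIntegral.integral_add (hi _ _) ((hcC x).intervalIntegrable _ _)]
    simp only [smul_add]
  rw [h1]
  refine continuous_const.sub ((intervalIntegral.continuous_primitive hi 0).add ?_)
  refine intervalIntegral.continuous_parametric_intervalIntegral_of_continuous ?_ continuous_id
  exact (by fun_prop : Continuous fun p : ℝ × ℝ => cexp (-(2 * I * l * p.2))).smul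
    (hC.continuous.comp (by fun_prop : Continuous fun p : ℝ × ℝ => (p.1, p.1 - p.2)))

theorem continuous_kreinExp (l : ℂ) : Continuous (kreinExp H C l) :=
  (by fun_prop : Continuous fun x : ℝ => cexp (I * l * x)).smul (hC.continuous_kreinP l)

variable [CompleteSpace A]

/-- Bellman–Krein rewrites `H(u) + C(x,x-u)` as `τ(u) + ∫_u^x τ(y)R(y,u) dy`. After exchanging the
integrals, everything is `τ(y)` times the expression of `exp_smul_kreinP_neg`. -/
theorem kreinP_eq (hBK : ∀ x ∈ Icc (0 : ℝ) 1, ∀ u ∈ Icc (0 : ℝ) 1, C x (x - u) =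
      C u 0 + ∫ y in u..x, kreinPotential H C y * kreinKernel H C y u)
    (l : ℂ) {x : ℝ} (hx : x ∈ Icc (0 : ℝ) 1) :
    kreinP H C l x = 1 - ∫ y in (0 : ℝ)..x, kreinPotential H C y *
      (cexp (-(2 * I * l * y)) • kreinP H C (-l) y) := by
  have hec : Continuous fun u : ℝ => cexp (-(2 * I * l * u)) • (1 : A) := by fun_prop
  have hcW := hC.continuous_integral_potential_mul_kernel continuous_id (continuous_const (y := x))
    continuous_id
  have i1 := hC.intervalIntegrable_potential_mul hec 0 x
  have i2 : IntervalIntegrable (fun u : ℝ => (∫ y in u..x, kreinPotential H C y *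
      kreinKernel H C y u) * (cexp (-(2 * I * l * u)) • (1 : A))) volume 0 x :=
    (hcW.mul hec).intervalIntegrable _ _
  have e1 : ∫ u in (0 : ℝ)..x, cexp (-(2 * I * l * u)) • (H u + C x (x - u)) =
      ∫ u in (0 : ℝ)..x, (kreinPotential H C u * (cexp (-(2 * I * l * u)) • (1 : A)) +
        (∫ y in u..x, kreinPotential H C y * kreinKernel H C y u) *
          (cexp (-(2 * I * l * u)) • (1 : A))) := by
    refine intervalIntegral.integral_congr_ae (Eventually.of_forall fun u hu => ?_)
    rw [uIoc_of_le hx.1] at hu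
    have hu' : u ∈ Ioc (0 : ℝ) 1 := ⟨hu.1, hu.2.trans hx.2⟩
    rw [hBK x hx u (Ioc_subset_Icc_self hu'), ← add_mul, mul_smul_comm, mul_one, ← add_assoc]
    congr 2
    rw [kreinPotential, kreinKernel_of_mem H C hu', sub_zero]
    abel
  rw [kreinP, e1, intervalIntegral.integral_add i1 i2, hC.integral_integral_kernel_mul hx.1
    ((hec.memLp_restrict_Icc 0 x).mono_measure
      (Measure.restrict_mono Ioc_subset_Icc_self le_rfl))]
  have hcP : Continuous fun y : ℝ => cexp (-(2 * I * l * y)) • kreinP H C (-l) y :=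
    (by fun_prop : Continuous fun y : ℝ => cexp (-(2 * I * l * y))).smul (hC.continuous_kreinP _)
  have e2 : ∫ y in (0 : ℝ)..x, kreinPotential H C y * ∫ v in (0 : ℝ)..y,
      kreinKernel H C y v * (cexp (-(2 * I * l * v)) • (1 : A)) =
      ∫ y in (0 : ℝ)..x, (kreinPotential H C y * (cexp (-(2 * I * l * y)) • kreinP H C (-l) y) -
        kreinPotential H C y * (cexp (-(2 * I * l * y)) • (1 : A))) := by
    refine intervalIntegral.integral_congr_ae (Eventually.of_forall fun y hy => ?_)
    rw [uIoc_of_le hx.1] at hy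
    rw [exp_smul_kreinP_neg l ⟨hy.1, hy.2.trans hx.2⟩, ← mul_sub, add_sub_cancel_left]
  rw [e2, intervalIntegral.integral_sub (hC.intervalIntegrable_potential_mul hcP 0 x) i1,
    add_sub_cancel]

/-- The Krein system `p_l' = il p_l - τ p_{-l}`, `p_l(0) = 1`. -/
theorem kreinExp_eq (hBK : ∀ x ∈ Icc (0 : ℝ) 1, ∀ u ∈ Icc (0 : ℝ) 1, C x (x - u) =
      C u 0 + ∫ y in u..x, kreinPotential H C y * kreinKernel H C y u)
    (l : ℂ) {x : ℝ} (hx : x ∈ Icc (0 : ℝ) 1) :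
    kreinExp H C l x = 1 + ∫ y in (0 : ℝ)..x, ((I * l) • kreinExp H C l y -
      kreinPotential H C y * kreinExp H C (-l) y) := by
  have hcP : Continuous fun y : ℝ => cexp (-(2 * I * l * y)) • kreinP H C (-l) y :=
    (by fun_prop : Continuous fun y : ℝ => cexp (-(2 * I * l * y))).smul (hC.continuous_kreinP _)
  have hig := hC.intervalIntegrable_potential_mul hcP
  have hd : ∀ x : ℝ, HasDerivAt (fun x : ℝ => cexp (I * l * x)) (I * l * cexp (I * l * x)) x :=
    fun x => by
      have h1 : HasDerivAt (fun x : ℝ => I * l * (x : ℂ)) (I * l) x := by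
        simpa using (hasDerivAt_id x).ofReal_comp.const_mul (I * l)
      simpa [mul_comm] using h1.cexp
  have hdc : Continuous fun x : ℝ => I * l * cexp (I * l * x) := by fun_prop
  have h1 := smul_integral_eq_integral hd hdc hx.1 (hig 0 x)
  have h2 : ∫ y in (0 : ℝ)..x, (I * l * cexp (I * l * y)) • (1 : A) =
      cexp (I * l * x) • (1 : A) - 1 := by
    rw [intervalIntegral.integral_smul_const, intervalIntegral.integral_eq_sub_of_hasDerivAt
      (fun y _ => hd y) (hdc.intervalIntegrable _ _), sub_smul]
    simp
  have j1 : IntervalIntegrable (fun y : ℝ => (I * l * cexp (I * l * y)) • (1 : A)) volume 0 x :=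
    (hdc.smul continuous_const).intervalIntegrable _ _
  have j2 : IntervalIntegrable (fun y : ℝ => (I * l * cexp (I * l * y)) •
      (∫ v in (0 : ℝ)..y, kreinPotential H C v * (cexp (-(2 * I * l * v)) • kreinP H C (-l) v)) +
      cexp (I * l * y) • (kreinPotential H C y * (cexp (-(2 * I * l * y)) • kreinP H C (-l) y)))
      volume 0 x :=
    ((hdc.smul (intervalIntegral.continuous_primitive hig 0)).intervalIntegrable _ _).add
      ((hig 0 x).continuousOn_smul (by fun_prop))
  rw [kreinExp, hC.kreinP_eq hBK l hx, smul_sub, h1, ← sub_add_cancel (cexp (I * l * x) • (1 : A)) 1,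
    ← h2, add_sub_right_comm, add_comm, ← intervalIntegral.integral_sub j1 j2]
  congr 1
  refine intervalIntegral.integral_congr fun y hy => ?_
  rw [uIcc_of_le hx.1] at hy
  conv_rhs => rw [kreinExp, hC.kreinP_eq hBK l ⟨hy.1, hy.2.trans hx.2⟩]
  have e3 : cexp (I * l * y) • (kreinPotential H C y *
      (cexp (-(2 * I * l * y)) • kreinP H C (-l) y)) =
      kreinPotential H C y * kreinExp H C (-l) y := by
    rw [kreinExp, mul_smul_comm, mul_smul_comm, smul_smul, ← Complex.exp_add]
    congr 2
    ring
  rw [e3, smul_smul, smul_sub, sub_sub]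

/-- Half-difference (over `i`) and half-sum of the Krein systems for `l` and `-l`. -/
theorem sine_system (hBK : ∀ x ∈ Icc (0 : ℝ) 1, ∀ u ∈ Icc (0 : ℝ) 1, C x (x - u) =
      C u 0 + ∫ y in u..x, kreinPotential H C y * kreinKernel H C y u) (l : ℂ) :
    ∃ φ ψ : ℝ → A, Continuous φ ∧ Continuous ψ ∧ φ 0 = 0 ∧ ψ 0 = 1 ∧
      (∀ x ∈ Icc (0 : ℝ) 1, φ x = ∫ y in (0 : ℝ)..x, (l • ψ y + kreinPotential H C y * φ y)) ∧
      (∀ x ∈ Icc (0 : ℝ) 1, ψ x = 1 + ∫ y in (0 : ℝ)..x,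
        (-(l • φ y) - kreinPotential H C y * ψ y)) ∧
      (∀ x ∈ Icc (0 : ℝ) 1, φ x = sin (l * x) • (1 : A) +
        ∫ s in (0 : ℝ)..x, sin (l * (2 * s - x)) • kreinKernel H C x s) ∧
      (∀ x ∈ Icc (0 : ℝ) 1, ψ x = cos (l * x) • (1 : A) +
        ∫ s in (0 : ℝ)..x, cos (l * (2 * s - x)) • kreinKernel H C x s) := by
  have hp := hC.continuous_kreinExp
  have hpi : ∀ l x, IntervalIntegrable (fun y => (I * l) • kreinExp H C l y -
      kreinPotential H C y * kreinExp H C (-l) y) volume 0 x := fun l x =>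
    ((continuous_const.smul (hp l)).intervalIntegrable _ _).sub
      (hC.intervalIntegrable_potential_mul (hp _) _ _)
  have h0 : ∀ l, kreinExp H C l 0 = 1 := fun l => by simp [kreinExp, kreinP]
  have hki : ∀ (l : ℂ) (x : ℝ), IntervalIntegrable (fun s : ℝ => cexp (I * l * (2 * s - x)) •
      kreinKernel H C x s) volume 0 x := fun l x =>
    (hC.intervalIntegrable_kernel x 0 x).continuousOn_smul (by fun_prop)
  refine ⟨fun x => (-(I / 2)) • (kreinExp H C l x - kreinExp H C (-l) x),
    fun x => (1 / 2 : ℂ) • (kreinExp H C l x + kreinExp H C (-l) x),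
    continuous_const.smul ((hp _).sub (hp _)), continuous_const.smul ((hp _).add (hp _)),
    by simp [h0], ?_, fun x hx => ?_, fun x hx => ?_, fun x hx => ?_, fun x hx => ?_⟩
  · simp only [h0]
    rw [← two_smul ℂ, smul_smul]
    simp
  · simp only
    rw [hC.kreinExp_eq hBK l hx, hC.kreinExp_eq hBK (-l) hx, add_sub_add_left_eq_sub,
      ← intervalIntegral.integral_sub (hpi _ _) (hpi _ _), ← intervalIntegral.integral_smul]
    refine intervalIntegral.integral_congr fun y _ => ?_
    simp only [neg_neg, mul_smul_comm, mul_sub]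
    have := I_mul_I
    match_scalars <;> grind
  · simp only
    rw [hC.kreinExp_eq hBK l hx, hC.kreinExp_eq hBK (-l) hx, add_add_add_comm,
      ← intervalIntegral.integral_add (hpi _ _) (hpi _ _), smul_add,
      ← intervalIntegral.integral_smul, ← two_smul ℂ, smul_smul]
    norm_num
    refine intervalIntegral.integral_congr fun y _ => ?_
    simp only [mul_smul_comm, mul_add]
    have := I_mul_I
    match_scalars <;> grind
  -- The kernel representation of `kreinExp` requires `x > 0`, since `kreinKernel` drops `C` at `x =
  -- 0`; there the integral is empty.
  · rcases eq_or_lt_of_le hx.1 with rfl | hx0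
    · simp [h0]
    simp only
    rw [kreinExp_eq_integral_kernel l ⟨hx0, hx.2⟩, kreinExp_eq_integral_kernel (-l) ⟨hx0, hx.2⟩,
      add_sub_add_comm, ← sub_smul, ← intervalIntegral.integral_sub (hki _ _) (hki _ _),
      smul_add, smul_smul, ← intervalIntegral.integral_smul]
    congr 1
    · congr 1
      rw [Complex.sin]
      ring_nf
    · refine intervalIntegral.integral_congr fun s _ => ?_
      rw [← sub_smul, smul_smul]
      congr 1
      rw [Complex.sin]
      ring_nf
  · rcases eq_or_lt_of_le hx.1 with rfl | hx0
    · simp only [h0]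
      rw [← two_smul ℂ, smul_smul]
      simp
    simp only
    rw [kreinExp_eq_integral_kernel l ⟨hx0, hx.2⟩, kreinExp_eq_integral_kernel (-l) ⟨hx0, hx.2⟩,
      add_add_add_comm, ← add_smul, ← intervalIntegral.integral_add (hki _ _) (hki _ _),
      smul_add, smul_smul, ← intervalIntegral.integral_smul]
    congr 1
    · congr 1
      rw [Complex.cos]
      ring_nf
    · refine intervalIntegral.integral_congr fun s _ => ?_
      rw [← add_smul, smul_smul]
      congr 1
      rw [Complex.cos]
      ring_nf

end IsKreinPair

end DiracSystem

/-! ### The Cauchy problems: uniqueness and existence -/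

section Cauchy

variable {r : ℕ}

instance : IsFiniteMeasure mu01 := by
  unfold mu01
  infer_instance

theorem mu01_eq_restrict_Ioc : mu01 = volume.restrict (Ioc 0 1) :=
  Measure.restrict_congr_set Ioo_ae_eq_Ioc

theorem intervalIntegrable_of_memLp_mu01 {E : Type*} [NormedAddCommGroup E] {v : ℝ → E}
    (hv : MemLp v 2 mu01) {a b : ℝ} (ha : a ∈ Icc (0 : ℝ) 1) (hb : b ∈ Icc (0 : ℝ) 1) :
    IntervalIntegrable v volume a b := by
  have h1 : IntegrableOn v (Ioc 0 1) volume := by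
    rw [IntegrableOn, ← mu01_eq_restrict_Ioc]
    exact hv.integrable (by norm_num)
  exact ⟨h1.mono_set (Ioc_subset_Ioc ha.1 hb.2), h1.mono_set (Ioc_subset_Ioc hb.1 ha.2)⟩

theorem memLp_mu01_of_continuousOn {E : Type*} [NormedAddCommGroup E] {f : ℝ → E}
    (hf : ContinuousOn f (Icc 0 1)) : MemLp f 2 mu01 := by
  obtain ⟨K, hK⟩ := isCompact_Icc.exists_bound_of_continuousOn hf
  refine MemLp.of_bound ((hf.mono Ioo_subset_Icc_self).aestronglyMeasurable measurableSet_Ioo) K ?_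
  exact ae_restrict_of_forall_mem measurableSet_Ioo fun x hx => hK x (Ioo_subset_Icc_self hx)

theorem memLp_mu01_mul_of_continuousOn {A : Type*} [NormedRing A] {τ f : ℝ → A}
    (hτ : MemLp τ 2 mu01) (hf : ContinuousOn f (Icc 0 1)) : MemLp (fun x => τ x * f x) 2 mu01 := by
  obtain ⟨K, hK⟩ := isCompact_Icc.exists_bound_of_continuousOn hf
  have hm := (hf.mono Ioo_subset_Icc_self).aestronglyMeasurable (μ := volume) measurableSet_Ioo
  refine MemLp.of_le_mul (c := K) hτ (hτ.1.mul hm) ?_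
  refine ae_restrict_of_forall_mem measurableSet_Ioo fun x hx => ?_
  rw [mul_comm K]
  refine (norm_mul_le _ _).trans ?_
  gcongr
  exact hK x (Ioo_subset_Icc_self hx)

/-- Cauchy–Schwarz moves the L² weight `k` into a constant, reducing to
`eq_zero_of_le_sqrt_integral_sq`. -/
theorem eq_zero_of_le_integral_mul {f k : ℝ → ℝ} (hf : ContinuousOn f (Icc 0 1))
    (hk : MemLp k 2 mu01) (hf0 : ∀ x, 0 ≤ f x) (hk0 : ∀ x, 0 ≤ k x)
    (h : ∀ x ∈ Icc (0 : ℝ) 1, f x ≤ ∫ t in (0 : ℝ)..x, k t * f t) :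
    ∀ x ∈ Icc (0 : ℝ) 1, f x = 0 := by
  refine eq_zero_of_le_sqrt_integral_sq (K := √(∫ t, k t ^ 2 ∂mu01)) hf
    (fun x _ => hf0 x) fun x hx => ?_
  refine (h x hx).trans ?_
  rw [intervalIntegral.integral_of_le hx.1, intervalIntegral.integral_of_le hx.1]
  have hle : volume.restrict (Ioc 0 x) ≤ mu01 := by
    rw [mu01_eq_restrict_Ioc]
    exact Measure.restrict_mono (Ioc_subset_Ioc_right hx.2) le_rfl
  have hfL := memLp_mu01_of_continuousOn hf
  have h1 := integral_norm_mul_norm_le (hk.mono_measure hle) (hfL.mono_measure hle)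
  simp only [Real.norm_of_nonneg (hk0 _), Real.norm_of_nonneg (hf0 _)] at h1
  refine h1.trans ?_
  gcongr
  · exact Eventually.of_forall fun t => sq_nonneg _
  · exact hk.integrable_sq

theorem norm_add_norm_le_of_system {A : Type*} [NormedRing A] [NormedAlgebra ℂ A]
    {T U W U' W' : A} {c : ℂ} (h1 : U' = W + T * U) (h2 : W' = -(T * W) - c • U) :
    ‖U'‖ + ‖W'‖ ≤ (1 + ‖c‖ + ‖T‖) * (‖U‖ + ‖W‖) := by
  have n1 := norm_mul_le T U
  have n2 := norm_mul_le T W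
  have n3 := norm_add_le W (T * U)
  have n4 := norm_sub_le (-(T * W)) (c • U)
  rw [norm_neg, norm_smul] at n4
  rw [h1, h2]
  nlinarith [norm_nonneg U, mul_nonneg (norm_nonneg c) (norm_nonneg W)]

section System

variable {A : Type*} [NormedRing A] [NormedAlgebra ℂ A]

theorem continuousOn_of_eq_integral {u v : ℝ → A} (hv : MemLp v 2 mu01)
    (hu : ∀ x ∈ Icc (0 : ℝ) 1, u x = u 0 + ∫ t in (0 : ℝ)..x, v t) :
    ContinuousOn u (Icc 0 1) := by
  have h1 := intervalIntegral.continuousOn_primitive_interval'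
    (intervalIntegrable_of_memLp_mu01 hv (left_mem_Icc.2 zero_le_one)
      (right_mem_Icc.2 zero_le_one)) (left_mem_uIcc)
  rw [uIcc_of_le zero_le_one] at h1
  exact (continuousOn_const.add h1).congr hu

/-- A first-order system `u' = w + τ u`, `w' = -τ w - c u` with zero initial data has only the
trivial absolutely continuous solution. -/
theorem eq_zero_of_system {τ u u' w w' : ℝ → A} {c : ℂ} (hτ : MemLp τ 2 mu01)
    (hu' : MemLp u' 2 mu01) (hw' : MemLp w' 2 mu01)
    (hu : ∀ x ∈ Icc (0 : ℝ) 1, u x = ∫ t in (0 : ℝ)..x, u' t)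
    (hw : ∀ x ∈ Icc (0 : ℝ) 1, w x = ∫ t in (0 : ℝ)..x, w' t)
    (h1 : ∀ᵐ t ∂mu01, u' t = w t + τ t * u t)
    (h2 : ∀ᵐ t ∂mu01, w' t = -(τ t * w t) - c • u t) : ∀ x ∈ Icc (0 : ℝ) 1, u x = 0 := by
  have h0 : (0 : ℝ) ∈ Icc (0 : ℝ) 1 := left_mem_Icc.2 zero_le_one
  have cu := continuousOn_of_eq_integral (u := u) hu' fun x hx => by rw [hu 0 h0]; simp [hu x hx]
  have cw := continuousOn_of_eq_integral (u := w) hw' fun x hx => by rw [hw 0 h0]; simp [hw x hx]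
  have hfc : ContinuousOn (fun x => ‖u x‖ + ‖w x‖) (Icc 0 1) := cu.norm.add cw.norm
  have hkL : MemLp (fun x => 1 + ‖c‖ + ‖τ x‖) 2 mu01 := (memLp_const (1 + ‖c‖)).add hτ.norm
  have hae : ∀ᵐ t ∂mu01, ‖u' t‖ + ‖w' t‖ ≤ (1 + ‖c‖ + ‖τ t‖) * (‖u t‖ + ‖w t‖) := by
    filter_upwards [h1, h2] with t h1 h2
    exact norm_add_norm_le_of_system h1 h2
  rw [mu01, Measure.restrict_congr_set Ioo_ae_eq_Icc] at hae
  have hf0 := eq_zero_of_le_integral_mul hfc hkL (fun x => by positivity) (fun x => by positivity)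
    fun x hx => by
      have iu := (intervalIntegrable_of_memLp_mu01 hu' h0 hx).norm
      have iw := (intervalIntegrable_of_memLp_mu01 hw' h0 hx).norm
      have hkf := intervalIntegrable_of_memLp_mu01 (memLp_mu01_mul_of_continuousOn hkL hfc) h0 hx
      rw [hu x hx, hw x hx]
      refine (add_le_add (intervalIntegral.norm_integral_le_integral_norm hx.1)
        (intervalIntegral.norm_integral_le_integral_norm hx.1)).trans ?_
      refine (intervalIntegral.integral_add iu iw).symm.trans_le ?_
      refine intervalIntegral.integral_mono_ae_restrict hx.1 (iu.add iw) hkf ?_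
      exact ae_mono (Measure.restrict_mono (Icc_subset_Icc_right hx.2) le_rfl) hae
  intro x hx
  exact norm_le_zero_iff.1 ((le_add_of_nonneg_right (norm_nonneg _)).trans_eq (hf0 x hx))

end System

theorem IsW12.sub_eq_integral {u₁ u₂ v₁ v₂ : ℝ → Mr r} (h₁ : IsW12 u₁ v₁) (h₂ : IsW12 u₂ v₂)
    (h0 : u₁ 0 = u₂ 0) {x : ℝ} (hx : x ∈ Icc (0 : ℝ) 1) :
    u₁ x - u₂ x = ∫ t in (0 : ℝ)..x, (v₁ t - v₂ t) := by
  have hz : (0 : ℝ) ∈ Icc (0 : ℝ) 1 := left_mem_Icc.2 zero_le_one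
  rw [h₁.2 x hx, h₂.2 x hx, h0, add_sub_add_left_eq_sub,
    intervalIntegral.integral_sub (intervalIntegrable_of_memLp_mu01 h₁.1 hz hx)
      (intervalIntegrable_of_memLp_mu01 h₂.1 hz hx)]

/-- Uniqueness for the Cauchy problem. -/
theorem IsCauchySolution.eqOn {τ : ℝ → Mr r} (hτ : MemLp τ 2 mu01) {l : ℂ} {a b : Mr r}
    {u₁ u₂ : ℝ → Mr r} (h₁ : IsCauchySolution τ l a b u₁) (h₂ : IsCauchySolution τ l a b u₂) :
    EqOn u₁ u₂ (Icc 0 1) := by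
  obtain ⟨u₁', w₁, w₁', hu₁, hw₁, e₁, d₁, a₁, b₁⟩ := h₁
  obtain ⟨u₂', w₂, w₂', hu₂, hw₂, e₂, d₂, a₂, b₂⟩ := h₂
  intro x hx
  refine sub_eq_zero.1 (eq_zero_of_system (c := l ^ 2) (u := fun x => u₁ x - u₂ x)
    (u' := fun x => u₁' x - u₂' x) (w := fun x => w₁ x - w₂ x) (w' := fun x => w₁' x - w₂' x) hτ
    (hu₁.1.sub hu₂.1) (hw₁.1.sub hw₂.1) (fun x hx => hu₁.sub_eq_integral hu₂ (a₁.trans a₂.symm) hx)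
    (fun x hx => hw₁.sub_eq_integral hw₂ (b₁.trans b₂.symm) hx) ?_ ?_ x hx)
  · filter_upwards [e₁, e₂] with t e₁ e₂
    rw [e₁, e₂, mul_sub]
    abel
  · filter_upwards [d₁, d₂] with t d₁ d₂
    rw [smul_sub, ← d₁, ← d₂, mul_sub]
    abel

variable {H : ℝ → Mr r} {C : ℝ → ℝ → Mr r}

/-- One first-order system serves both problems: `lψ` is the quasi-derivative of `φ`, and `-lφ` is
that of `ψ`. No division by `l` occurs, so `l = 0` needs no separate treatment. -/
theorem IsKreinPair.exists_phi_psi (hC : IsKreinPair H C)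
    (hBK : ∀ x ∈ Icc (0 : ℝ) 1, ∀ u ∈ Icc (0 : ℝ) 1, C x (x - u) =
      C u 0 + ∫ y in u..x, kreinPotential H C y * kreinKernel H C y u)
    {τ : ℝ → Mr r} (hτ : ∀ᵐ x ∂mu01, τ x = kreinPotential H C x) (l : ℂ) :
    ∃ φ ψ : ℝ → Mr r, IsPhi τ l φ ∧ IsPsi τ l ψ ∧
      (∀ x ∈ Icc (0 : ℝ) 1, φ x = Complex.sin (l * x) • (1 : Mr r) +
        ∫ s in (0 : ℝ)..x, Complex.sin (l * (2 * s - x)) • kreinKernel H C x s) ∧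
      (∀ x ∈ Icc (0 : ℝ) 1, ψ x = Complex.cos (l * x) • (1 : Mr r) +
        ∫ s in (0 : ℝ)..x, Complex.cos (l * (2 * s - x)) • kreinKernel H C x s) := by
  obtain ⟨φ, ψ, hφc, hψc, hφ0, hψ0, hφ, hψ, hφk, hψk⟩ := hC.sine_system hBK l
  have hpL : MemLp (kreinPotential H C) 2 mu01 := hC.memLp_potential.restrict _
  have mφ := memLp_mu01_mul_of_continuousOn hpL hφc.continuousOn
  have mψ := memLp_mu01_mul_of_continuousOn hpL hψc.continuousOn
  have cφ : MemLp φ 2 mu01 := memLp_mu01_of_continuousOn hφc.continuousOn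
  have cψ : MemLp ψ 2 mu01 := memLp_mu01_of_continuousOn hψc.continuousOn
  have Wφ : IsW12 φ fun y => l • ψ y + kreinPotential H C y * φ y :=
    ⟨(cψ.const_smul l).add mφ, fun x hx => by rw [hφ0, zero_add]; exact hφ x hx⟩
  have Wψ : IsW12 ψ fun y => -(l • φ y) - kreinPotential H C y * ψ y :=
    ⟨(cφ.const_smul l).neg.sub mψ, fun x hx => by rw [hψ0]; exact hψ x hx⟩
  have Wsmul : ∀ (c : ℂ) (u v : ℝ → Mr r), IsW12 u v → IsW12 (fun x => c • u x) fun x => c • v x :=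
    fun c u v h => ⟨h.1.const_smul c, fun x hx => by
      simp only
      rw [h.2 x hx, smul_add, intervalIntegral.integral_smul]⟩
  refine ⟨φ, ψ, ⟨_, fun x => l • ψ x, _, Wφ, Wsmul l _ _ Wψ, ?_, ?_, hφ0, congrArg (l • ·) hψ0⟩,
    ⟨_, fun x => -l • φ x, _, Wψ, Wsmul (-l) _ _ Wφ, ?_, ?_, hψ0, (congrArg (-l • ·) hφ0).trans (smul_zero _)⟩, hφk, hψk⟩
  · filter_upwards [hτ] with x hx
    rw [hx]
    abel
  · filter_upwards [hτ] with x hx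
    rw [hx, mul_smul_comm, smul_sub, smul_neg, smul_smul, pow_two]
    abel
  · filter_upwards [hτ] with x hx
    rw [hx, neg_smul, neg_mul]
    abel
  · filter_upwards [hτ] with x hx
    rw [hx, mul_smul_comm, smul_add, smul_smul, pow_two]
    simp only [neg_mul, neg_smul, smul_neg]
    abel

end Cauchy

/-! ### Completeness of sines and cosines -/

section Completeness

variable {E : Type*} [NormedAddCommGroup E] [NormedSpace ℂ E]

/-- Product-to-sum trades one factor `cos t` for the frequencies `l ± 1`, so the induction keeps `l`
general. -/
theorem integral_cos_pow_mul_cos_smul_eq_zero {f : ℝ → E} {x : ℝ}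
    (hf : IntervalIntegrable f volume 0 x)
    (h : ∀ l : ℝ, ∫ t in (0 : ℝ)..x, Real.cos (l * t) • f t = 0) (k : ℕ) (l : ℝ) :
    ∫ t in (0 : ℝ)..x, (Real.cos t ^ k * Real.cos (l * t)) • f t = 0 := by
  induction k generalizing l with
  | zero => simpa using h l
  | succ k ih =>
    have hi : ∀ l : ℝ, IntervalIntegrable (fun t => (Real.cos t ^ k * Real.cos (l * t)) • f t)
        volume 0 x := fun l => hf.continuousOn_smul (by fun_prop)
    have h1 := intervalIntegral.integral_add (hi (l + 1)) (hi (l - 1))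
    rw [ih, ih, add_zero] at h1
    have h2 : ∫ t in (0 : ℝ)..x, (Real.cos t ^ (k + 1) * Real.cos (l * t)) • f t =
        (1 / 2 : ℝ) • ∫ t in (0 : ℝ)..x, ((Real.cos t ^ k * Real.cos ((l + 1) * t)) • f t +
          (Real.cos t ^ k * Real.cos ((l - 1) * t)) • f t) := by
      rw [← intervalIntegral.integral_smul]
      refine intervalIntegral.integral_congr fun t _ => ?_
      rw [← add_smul, smul_smul]
      congr 1
      rw [add_mul, sub_mul, one_mul, Real.cos_add, Real.cos_sub]
      ring
    rw [h2, h1, smul_zero]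

theorem integral_polynomial_cos_smul_eq_zero {f : ℝ → E} {x : ℝ}
    (hf : IntervalIntegrable f volume 0 x)
    (h : ∀ l : ℝ, ∫ t in (0 : ℝ)..x, Real.cos (l * t) • f t = 0) (p : Polynomial ℝ) :
    ∫ t in (0 : ℝ)..x, (p.eval (Real.cos t)) • f t = 0 := by
  induction p using Polynomial.induction_on' with
  | add p q hp hq =>
    simp only [Polynomial.eval_add, add_smul]
    rw [intervalIntegral.integral_add, hp, hq, add_zero] <;>
    exact hf.continuousOn_smul (by fun_prop)
  | monomial n a =>
    have := integral_cos_pow_mul_cos_smul_eq_zero hf h n 0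
    simp only [zero_mul, Real.cos_zero, mul_one] at this
    simp only [Polynomial.eval_monomial, mul_smul, intervalIntegral.integral_smul, this, smul_zero]

theorem integral_smul_eq_zero_of_cos {f : ℝ → E} {x : ℝ} (hx : x ∈ Icc (0 : ℝ) 1)
    (hf : IntervalIntegrable f volume 0 x)
    (h : ∀ l : ℝ, ∫ t in (0 : ℝ)..x, Real.cos (l * t) • f t = 0) {g : ℝ → ℝ} (hg : Continuous g) :
    ∫ t in (0 : ℝ)..x, g t • f t = 0 := by
  rw [← norm_le_zero_iff]
  refine le_of_forall_pos_le_add fun ε hε => ?_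
  rw [zero_add]
  set N := ∫ t in (0 : ℝ)..x, ‖f t‖ with hN
  have hN0 : 0 ≤ N := intervalIntegral.integral_nonneg hx.1 fun _ _ => norm_nonneg _
  -- Weierstrass for `g ∘ arccos`: since `x ≤ 1 < π`, `arccos (cos t) = t` on the interval, so
  -- polynomials in `cos t` approximate `g`. Dividing by `N + 1` avoids the case `N = 0`.
  obtain ⟨p, hp⟩ := exists_polynomial_near_of_continuousOn (-1) 1 (fun y => g (Real.arccos y))
    (by fun_prop) (ε / (N + 1)) (by positivity)
  have hi : ∀ g : ℝ → ℝ, Continuous g → IntervalIntegrable (fun t => g t • f t) volume 0 x :=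
    fun g hg => hf.continuousOn_smul hg.continuousOn
  have h1 : ∫ t in (0 : ℝ)..x, g t • f t =
      ∫ t in (0 : ℝ)..x, (g t - p.eval (Real.cos t)) • f t := by
    simp only [sub_smul]
    rw [intervalIntegral.integral_sub (hi _ hg) (hi _ (by fun_prop)),
      integral_polynomial_cos_smul_eq_zero hf h, sub_zero]
  rw [h1]
  calc _ ≤ ∫ t in (0 : ℝ)..x, ε / (N + 1) * ‖f t‖ := by
        refine intervalIntegral.norm_integral_le_of_norm_le hx.1
          (Eventually.of_forall fun t ht => ?_) (hf.norm.const_mul _)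
        rw [norm_smul]
        gcongr
        have h2 := hp (Real.cos t) ⟨Real.neg_one_le_cos t, Real.cos_le_one t⟩
        rw [Real.arccos_cos ht.1.le (by linarith [ht.2, hx.2, Real.pi_gt_three])] at h2
        rw [Real.norm_eq_abs, abs_sub_comm]
        exact h2.le
    _ = ε * (N / (N + 1)) := by rw [intervalIntegral.integral_const_mul]; ring
    _ ≤ ε * 1 := by
        gcongr
        rw [div_le_one (by positivity)]
        linarith
    _ = ε := mul_one ε

variable [CompleteSpace E]

/-- Completeness of the cosines on `(0,x)`. -/
theorem ae_eq_zero_of_integral_cos_smul {f : ℝ → E} {x : ℝ} (hx : x ∈ Icc (0 : ℝ) 1)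
    (hf : IntervalIntegrable f volume 0 x)
    (h : ∀ l : ℝ, ∫ t in (0 : ℝ)..x, Real.cos (l * t) • f t = 0) :
    ∀ᵐ t ∂volume.restrict (Ioc 0 x), f t = 0 := by
  have h1 := (intervalIntegrable_iff_integrableOn_Ioc_of_le hx.1).1 hf
  refine ae_eq_zero_of_integral_contDiff_smul_eq_zero h1.locallyIntegrable fun g hg _ => ?_
  rw [← intervalIntegral.integral_of_le hx.1]
  exact integral_smul_eq_zero_of_cos hx hf h hg.continuous

/-- Completeness of the sines on `(0,x)`. -/
theorem ae_eq_zero_of_integral_sin_smul {f : ℝ → E} {x : ℝ} (hx : x ∈ Icc (0 : ℝ) 1)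
    (hf : IntervalIntegrable f volume 0 x)
    (h : ∀ l : ℝ, ∫ t in (0 : ℝ)..x, Real.sin (l * t) • f t = 0) :
    ∀ᵐ t ∂volume.restrict (Ioc 0 x), f t = 0 := by
  have hi : ∀ l : ℝ, IntervalIntegrable (fun t => Real.sin (l * t) • f t) volume 0 x :=
    fun l => hf.continuousOn_smul (by fun_prop)
  -- Since `cos(lt) sin t` is half a difference of sines, `sin t • f` is annihilated by all cosines;
  -- `sin t > 0` on `(0,1]` then gives `f = 0`.
  have h1 := ae_eq_zero_of_integral_cos_smul (f := fun t => Real.sin t • f t) hx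
    (hf.continuousOn_smul (by fun_prop)) fun l => by
      have h2 := intervalIntegral.integral_sub (hi (l + 1)) (hi (l - 1))
      rw [h, h, sub_zero] at h2
      have h3 : ∫ t in (0 : ℝ)..x, Real.cos (l * t) • Real.sin t • f t =
          (1 / 2 : ℝ) • ∫ t in (0 : ℝ)..x, (Real.sin ((l + 1) * t) • f t -
            Real.sin ((l - 1) * t) • f t) := by
        rw [← intervalIntegral.integral_smul]
        refine intervalIntegral.integral_congr fun t _ => ?_
        rw [← sub_smul, smul_smul, smul_smul]
        congr 1
        rw [add_mul, sub_mul, one_mul, Real.sin_add, Real.sin_sub]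
        ring
      rw [h3, h2, smul_zero]
  filter_upwards [h1, ae_restrict_mem measurableSet_Ioc] with t ht htx
  refine (smul_eq_zero.1 ht).resolve_left (Real.sin_pos_of_pos_of_lt_pi htx.1 ?_).ne'
  linarith [htx.2, hx.2, Real.pi_gt_three]

end Completeness

/-! ### Folding the integral by parity -/

section TransformationKernel

open scoped ENNReal

/-- The parity of `f` makes the second summand `F(-t)`, so the left side is `∫_{-x}^x F`; substitute
`t = 2s - x`. -/
theorem integral_smul_half_angle {E : Type*} [NormedAddCommGroup E] [NormedSpace ℂ E]
    {R : ℝ → E} (hR : ∀ a b, IntervalIntegrable R volume a b) {f : ℝ → ℂ} (hf : Continuous f)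
    {ε : ℂ} (hε : ∀ t, f (-t) = ε * f t) (x : ℝ) :
    ∫ t in (0 : ℝ)..x, f t • ((1 / 2 : ℂ) • (R ((x + t) / 2) + ε • R ((x - t) / 2))) =
      ∫ s in (0 : ℝ)..x, f (2 * s - x) • R s := by
  set F : ℝ → E := fun t => f t • ((1 / 2 : ℂ) • R ((x + t) / 2)) with hF
  have hFi : ∀ a b, IntervalIntegrable F volume a b := fun a b => by
    have h1 : IntervalIntegrable (fun t => R ((x + t) / 2)) volume a b := by
      have h2 := ((hR ((x + a) / 2) ((x + b) / 2)).comp_mul_left (c := 1 / 2)).comp_add_left x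
      have e1 : ∀ c : ℝ, (x + c) / 2 / (1 / 2) - x = c := fun c => by ring
      have e2 : ∀ t : ℝ, 1 / 2 * (x + t) = (x + t) / 2 := fun t => by ring
      simpa only [e1, e2] using h2
    exact (h1.smul _).continuousOn_smul hf.continuousOn
  have e1 : ∀ t, f t • ((1 / 2 : ℂ) • (R ((x + t) / 2) + ε • R ((x - t) / 2))) =
      F t + F (-t) := fun t => by
    simp only [hF, hε, ← sub_eq_add_neg, smul_add, smul_smul]
    congr 2
    ring
  have e2 := intervalIntegral.integral_comp_neg (a := 0) (b := x) F
  have e3 := intervalIntegral.integral_comp_mul_sub (a := 0) (b := x) F two_ne_zero x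
  have e4 : ∫ s in (0 : ℝ)..x, f (2 * s - x) • R s = (2 : ℝ) • ∫ s in (0 : ℝ)..x, F (2 * s - x) := by
    rw [← intervalIntegral.integral_smul]
    refine intervalIntegral.integral_congr fun s _ => ?_
    simp only [hF]
    rw [show (x + (2 * s - x)) / 2 = s by ring, smul_comm (f _) (1 / 2 : ℂ), ← Complex.coe_smul,
      smul_smul]
    norm_num
  have hFi' : IntervalIntegrable (fun t => F (-t)) volume 0 x := by
    simpa using (hFi 0 (-x)).comp_sub_left 0
  simp only [e1]
  rw [intervalIntegral.integral_add (hFi _ _) hFi', e2, e4, e3, add_comm, neg_zero,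
    intervalIntegral.integral_add_adjacent_intervals (hFi _ _) (hFi _ _), smul_smul]
  norm_num
  congr 1
  ring

end TransformationKernel

/-! ### The transformation kernels, their class and their uniqueness -/

section TransKernel

open scoped ENNReal

variable {A : Type*} [NormedRing A]

theorem memLp_comp_half {H : ℝ → A} (hH : MemLp H 2 volume) :
    MemLp (fun s => H (s / 2)) 2 volume := by
  have h1 : MemLp H 2 (Measure.map (fun s : ℝ => 2⁻¹ * s) volume) := by
    rw [Real.map_volume_mul_left (by norm_num)]
    exact hH.smul_measure (by simp)
  have h2 := h1.comp_of_map (by fun_prop)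
  simpa only [Function.comp_def, div_eq_inv_mul] using h2

theorem memLp_two_add_prod {H : ℝ → A} (hH : MemLp H 2 volume) (ν : Measure ℝ)
    [IsFiniteMeasure ν] : MemLp (fun p : ℝ × ℝ => H (p.1 + p.2)) 2 (volume.prod ν) := by
  have h1 : MemLp (fun p : ℝ × ℝ => H p.2) 2 (ν.prod volume) := hH.comp_snd ν
  have h2 : MeasurePreserving (fun p : ℝ × ℝ => (p.1, p.2 + p.1)) (ν.prod volume)
      (ν.prod volume) :=
    (MeasurePreserving.id ν).skew_product (g := fun y x => x + y) (by fun_prop)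
      (Eventually.of_forall fun y => (measurePreserving_add_right volume y).map_eq)
  exact (h1.comp_measurePreserving h2).comp_measurePreserving Measure.measurePreserving_swap

theorem Continuous.memLp_restrict_prod {c : ℝ × ℝ → A} (hc : Continuous c) {s t : Set ℝ}
    (hs : IsCompact s) (ht : IsCompact t) : MemLp c 2 (volume.restrict (s ×ˢ t)) := by
  obtain ⟨K, hK⟩ := (hs.prod ht).exists_bound_of_continuousOn hc.continuousOn
  have : IsFiniteMeasure ((volume : Measure (ℝ × ℝ)).restrict (s ×ˢ t)) :=
    isFiniteMeasure_restrict.2 (hs.prod ht).measure_lt_top.ne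
  exact MemLp.of_bound hc.aestronglyMeasurable K
    (ae_restrict_of_forall_mem (hs.prod ht).measurableSet hK)

theorem memLp_restrict_unitSquare {f : ℝ × ℝ → A}
    (hf : MemLp f 2 (volume.prod (volume.restrict (Icc (0 : ℝ) 1)))) :
    MemLp f 2 (volume.restrict (Icc (0 : ℝ) 1 ×ˢ Icc (0 : ℝ) 1)) := by
  rw [Measure.volume_eq_prod, ← Measure.prod_restrict]
  exact hf.mono_measure
    (Measure.prod_mono (μ := volume.restrict (Icc (0 : ℝ) 1)) Measure.restrict_le_self le_rfl)

theorem L2Continuous.memLp_and_tendsto {F K : ℝ → ℝ → A} (hF : L2Continuous F)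
    (h : ∀ x ∈ Icc (0 : ℝ) 1, K x =ᵐ[mu01] F x) :
    (∀ x ∈ Icc (0 : ℝ) 1, MemLp (K x) 2 mu01) ∧ ∀ x₀ ∈ Icc (0 : ℝ) 1,
      Tendsto (fun x => eLpNorm (fun t => K x t - K x₀ t) 2 mu01) (𝓝[Icc 0 1] x₀) (𝓝 0) := by
  refine ⟨fun x hx => (memLp_congr_ae (h x hx)).2 ((hF.1 x).restrict _), fun x₀ hx₀ => ?_⟩
  have h1 : Tendsto (fun x => eLpNorm (F x - F x₀) 2 mu01) (𝓝[Icc 0 1] x₀) (𝓝 0) :=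
    tendsto_of_tendsto_of_tendsto_of_le_of_le tendsto_const_nhds
      ((hF.2 x₀).mono_left nhdsWithin_le_nhds) (fun _ => zero_le)
      fun _ => eLpNorm_mono_measure _ Measure.restrict_le_self
  refine h1.congr' ?_
  filter_upwards [self_mem_nhdsWithin] with x hx
  exact eLpNorm_congr_ae ((h x hx).sub (h x₀ hx₀)).symm

variable [NormedAlgebra ℂ A]

theorem L2Continuous.const_smul {X : Type*} [TopologicalSpace X] {F : X → ℝ → A}
    (hF : L2Continuous F) (c : ℂ) : L2Continuous fun x ξ => c • F x ξ := by
  obtain ⟨h1, c1⟩ := l2Continuous_iff.1 hF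
  exact l2Continuous_iff.2 ⟨fun x => (h1 x).const_smul c, c1.const_smul c⟩

/-- The transformation kernel `½[R(x,(x+t)/2) + ε R(x,(x-t)/2)]` on the triangle, extended by
zero. -/
noncomputable def transKernel (H : ℝ → A) (C : ℝ → ℝ → A) (ε : ℂ) (x t : ℝ) : A :=
  (Icc 0 x).indicator (fun t => (1 / 2 : ℂ) • ((-H ((x - t) / 2) - C x ((x + t) / 2)) +
    ε • (-H ((x + t) / 2) - C x ((x - t) / 2)))) t

theorem transKernel_of_mem (H : ℝ → A) (C : ℝ → ℝ → A) (ε : ℂ) {x t : ℝ} (ht : t ∈ Icc 0 x) :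
    transKernel H C ε x t = (1 / 2 : ℂ) • ((-H (x - (x + t) / 2) - C x ((x + t) / 2)) +
      ε • (-H (x - (x - t) / 2) - C x ((x - t) / 2))) := by
  rw [transKernel, indicator_of_mem ht, show x - (x + t) / 2 = (x - t) / 2 by ring,
    show x - (x - t) / 2 = (x + t) / 2 by ring]

theorem integral_smul_transKernel {H : ℝ → A} {C : ℝ → ℝ → A} (hC : IsKreinPair H C) {f : ℝ → ℂ}
    (hf : Continuous f) {ε : ℂ} (hε : ∀ t, f (-t) = ε * f t) {x : ℝ} (hx : x ∈ Icc (0 : ℝ) 1) :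
    ∫ t in (0 : ℝ)..x, f t • transKernel H C ε x t =
      ∫ s in (0 : ℝ)..x, f (2 * s - x) • kreinKernel H C x s := by
  rw [← integral_smul_half_angle (hC.intervalIntegrable_kernel x) hf hε]
  refine intervalIntegral.integral_congr_ae (Eventually.of_forall fun t ht => ?_)
  rw [uIoc_of_le hx.1] at ht
  have hx' : x ∈ Ioc (0 : ℝ) 1 := ⟨ht.1.trans_le ht.2, hx.2⟩
  rw [transKernel_of_mem H C ε (Ioc_subset_Icc_self ht), kreinKernel_of_mem H C hx',
    kreinKernel_of_mem H C hx']

namespace IsKreinPair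

variable {H : ℝ → A} {C : ℝ → ℝ → A} (hC : IsKreinPair H C)
include hC

theorem continuous_add_half : Continuous fun p : ℝ × ℝ => C p.1 ((p.1 + p.2) / 2) :=
  hC.continuous.comp (by fun_prop : Continuous fun p : ℝ × ℝ => (p.1, (p.1 + p.2) / 2))

theorem continuous_sub_half : Continuous fun p : ℝ × ℝ => C p.1 ((p.1 - p.2) / 2) :=
  hC.continuous.comp (by fun_prop : Continuous fun p : ℝ × ℝ => (p.1, (p.1 - p.2) / 2))

/-- On a slice the kernel consists of a reflection and a translation of `H(·/2)` and two continuous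
terms, cut off to `(0,x]`; each ingredient varies continuously in L². -/
theorem transKernel_left (ε : ℂ) : ∃ F : ℝ → ℝ → A, L2Continuous F ∧
    ∀ x ∈ Icc (0 : ℝ) 1, transKernel H C ε x =ᵐ[mu01] F x := by
  have hg := memLp_comp_half hC.memLp
  refine ⟨_, ((((l2Continuous_reflect hg).neg.sub (l2Continuous_indicator_of_continuous
    (c := fun x t => C x ((x + t) / 2)) hC.continuous_add_half 0 1)).add
    (((l2Continuous_translate_add hg).neg.sub (l2Continuous_indicator_of_continuous
    (c := fun x t => C x ((x - t) / 2)) hC.continuous_sub_half 0 1)).const_smul ε)).const_smul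
    (1 / 2)).indicator_Ioc (continuous_const (y := 0)) continuous_id, fun x hx => ?_⟩
  refine ae_restrict_of_forall_mem measurableSet_Ioo fun t ht => ?_
  by_cases h : t ≤ x
  · have h1 : t ∈ Icc 0 x := ⟨ht.1.le, h⟩
    have h2 : t ∈ Ioc 0 (id x) := ⟨ht.1, h⟩
    have h3 : t ∈ Ioc (0 : ℝ) 1 := Ioo_subset_Ioc_self ht
    simp only [transKernel, indicator_of_mem h1, indicator_of_mem h2, indicator_of_mem h3,
      add_comm t x]
  · have h1 : t ∉ Icc 0 x := fun h' => h h'.2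
    have h2 : t ∉ Ioc 0 (id x) := fun h' => h h'.2
    simp only [transKernel, indicator_of_notMem h1, indicator_of_notMem h2]

/-- As for the other slices, with the cut-off `(t,1]`; the two sides may differ at the single point
`x = t`. -/
theorem transKernel_right (ε : ℂ) : ∃ F : ℝ → ℝ → A, L2Continuous F ∧
    ∀ t ∈ Icc (0 : ℝ) 1, (fun x => transKernel H C ε x t) =ᵐ[mu01] F t := by
  have hg := memLp_comp_half hC.memLp
  refine ⟨_, ((((l2Continuous_translate hg).neg.sub (l2Continuous_indicator_of_continuous
    (c := fun t x => C x ((x + t) / 2)) (hC.continuous_add_half.comp continuous_swap) 0 1)).add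
    (((l2Continuous_translate_add hg).neg.sub (l2Continuous_indicator_of_continuous
    (c := fun t x => C x ((x - t) / 2)) (hC.continuous_sub_half.comp continuous_swap)
      0 1)).const_smul ε)).const_smul
    (1 / 2)).indicator_Ioc continuous_id (continuous_const (y := 1)), fun t ht => ?_⟩
  have hne : ∀ᵐ x ∂mu01, x ≠ t := ae_restrict_of_ae (by simp [ae_iff])
  filter_upwards [hne, ae_restrict_mem measurableSet_Ioo] with x hxt hx
  by_cases h : t ≤ x
  · have h1 : t ∈ Icc 0 x := ⟨ht.1, h⟩
    have h2 : x ∈ Ioc (id t) 1 := ⟨lt_of_le_of_ne h (Ne.symm hxt), hx.2.le⟩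
    have h3 : x ∈ Ioc (0 : ℝ) 1 := Ioo_subset_Ioc_self hx
    simp only [transKernel, indicator_of_mem h1, indicator_of_mem h2, indicator_of_mem h3]
  · have h1 : t ∉ Icc 0 x := fun h' => h h'.2
    have h2 : x ∉ Ioc (id t) 1 := fun h' => h h'.1.le
    simp only [transKernel, indicator_of_notMem h1, indicator_of_notMem h2]

theorem memLp_transKernel (ε : ℂ) : MemLp (fun p : ℝ × ℝ => transKernel H C ε p.1 p.2) 2
    (volume.restrict (Icc (0 : ℝ) 1 ×ˢ Icc (0 : ℝ) 1)) := by
  have hg := memLp_comp_half hC.memLp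
  have h1 := memLp_restrict_unitSquare (memLp_two_sub_prod hg (volume.restrict (Icc (0 : ℝ) 1)))
  have h2 := memLp_restrict_unitSquare (memLp_two_add_prod hg (volume.restrict (Icc (0 : ℝ) 1)))
  have h3 := hC.continuous_add_half.memLp_restrict_prod (isCompact_Icc (a := (0 : ℝ)) (b := 1))
    (isCompact_Icc (a := (0 : ℝ)) (b := 1))
  have h4 := hC.continuous_sub_half.memLp_restrict_prod (isCompact_Icc (a := (0 : ℝ)) (b := 1))
    (isCompact_Icc (a := (0 : ℝ)) (b := 1))
  have hS : MeasurableSet {p : ℝ × ℝ | 0 ≤ p.2 ∧ p.2 ≤ p.1} :=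
    (measurableSet_le measurable_const measurable_snd).inter
      (measurableSet_le measurable_snd measurable_fst)
  exact (((h1.neg.sub h3).add ((h2.neg.sub h4).const_smul ε)).const_smul (1 / 2 : ℂ)).indicator hS

end IsKreinPair

theorem measurableSet_Omega : MeasurableSet Omega :=
  (measurableSet_le measurable_const measurable_snd).inter
    ((measurableSet_le measurable_snd measurable_fst).inter
      (measurableSet_le measurable_fst measurable_const))

theorem IsKreinPair.inG2Plus_transKernel {r : ℕ} {H : ℝ → Mr r} {C : ℝ → ℝ → Mr r}
    (hC : IsKreinPair H C) (ε : ℂ) : InG2Plus (transKernel H C ε) := by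
  obtain ⟨F, hF, hFK⟩ := hC.transKernel_left ε
  obtain ⟨G, hG, hGK⟩ := hC.transKernel_right ε
  obtain ⟨a1, a2⟩ := hF.memLp_and_tendsto hFK
  obtain ⟨b1, b2⟩ := hG.memLp_and_tendsto (K := fun t x => transKernel H C ε x t) hGK
  refine ⟨hC.memLp_transKernel ε, a1, a2, b1, b2, ?_⟩
  refine ae_restrict_of_forall_mem ((measurableSet_Icc.prod measurableSet_Icc).diff measurableSet_Omega)
    fun p hp => indicator_of_notMem (fun h => hp.2 ⟨h.1, h.2, hp.1.1.2⟩) _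

section Kernels

variable {r : ℕ} {H : ℝ → Mr r} {C : ℝ → ℝ → Mr r} (hC : IsKreinPair H C)
  (hBK : ∀ x ∈ Icc (0 : ℝ) 1, ∀ u ∈ Icc (0 : ℝ) 1, C x (x - u) =
    C u 0 + ∫ y in u..x, kreinPotential H C y * kreinKernel H C y u)
  {τ : ℝ → Mr r} (hτL : MemLp τ 2 mu01) (hτ : ∀ᵐ x ∂mu01, τ x = kreinPotential H C x)
include hC hBK hτ

include hτL in
-- The sign is `-1` because sine is odd. Uniqueness of the Cauchy problem carries the formula from
-- the constructed solution to an arbitrary one.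
theorem isKernelD_transKernel : IsKernelD τ (transKernel H C (-1)) := by
  refine ⟨hC.inG2Plus_transKernel _, fun l => ?_⟩
  obtain ⟨φ, -, hφ, -, hφk, -⟩ := hC.exists_phi_psi hBK hτ l
  refine ⟨⟨φ, hφ⟩, fun φ' hφ' x hx => ?_⟩
  have h1 := integral_smul_transKernel hC (f := fun t => Complex.sin (l * t)) (by fun_prop)
    (ε := -1) (fun t => by simp) hx
  rw [IsCauchySolution.eqOn hτL hφ' hφ hx, hφk x hx, h1]
  push_cast
  rfl

include hτL in
theorem isKernelN_transKernel : IsKernelN τ (transKernel H C 1) := by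
  refine ⟨hC.inG2Plus_transKernel _, fun l => ?_⟩
  obtain ⟨-, ψ, -, hψ, -, hψk⟩ := hC.exists_phi_psi hBK hτ l
  refine ⟨⟨ψ, hψ⟩, fun ψ' hψ' x hx => ?_⟩
  have h1 := integral_smul_transKernel hC (f := fun t => Complex.cos (l * t)) (by fun_prop)
    (ε := 1) (fun t => by simp) hx
  rw [IsCauchySolution.eqOn hτL.neg hψ' hψ hx, hψk x hx, h1]
  push_cast
  rfl

end Kernels

/-- Both kernels represent the same solution, so on each slice their difference is annihilated by
every `sin(lt)`; real `l` suffice. -/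
theorem IsKernelD.ae_eq {r : ℕ} {τ : ℝ → Mr r} {K₁ K₂ : ℝ → ℝ → Mr r} (h₁ : IsKernelD τ K₁)
    (h₂ : IsKernelD τ K₂) {x : ℝ} (hx : x ∈ Icc (0 : ℝ) 1) :
    ∀ᵐ t ∂volume.restrict (Ioc 0 x), K₁ x t = K₂ x t := by
  have h0 : (0 : ℝ) ∈ Icc (0 : ℝ) 1 := left_mem_Icc.2 zero_le_one
  have i1 := intervalIntegrable_of_memLp_mu01 (h₁.1.memLp_left x hx) h0 hx
  have i2 := intervalIntegrable_of_memLp_mu01 (h₂.1.memLp_left x hx) h0 hx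
  have h3 := ae_eq_zero_of_integral_sin_smul hx (i1.sub i2) fun l => by
    obtain ⟨⟨φ, hφ⟩, hk⟩ := h₁.2 l
    have e := add_left_cancel ((hk φ hφ x hx).symm.trans ((h₂.2 l).2 φ hφ x hx))
    have j1 : IntervalIntegrable (fun t : ℝ => Complex.sin (l * t) • K₁ x t) volume 0 x :=
      i1.continuousOn_smul (by fun_prop)
    have j2 : IntervalIntegrable (fun t : ℝ => Complex.sin (l * t) • K₂ x t) volume 0 x :=
      i2.continuousOn_smul (by fun_prop)
    rw [← sub_eq_zero, ← intervalIntegral.integral_sub j1 j2] at e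
    rw [← e]
    refine intervalIntegral.integral_congr fun t _ => ?_
    rw [← smul_sub, ← Complex.coe_smul]
    push_cast
    rfl
  filter_upwards [h3] with t ht
  exact sub_eq_zero.1 ht

theorem IsKernelN.ae_eq {r : ℕ} {τ : ℝ → Mr r} {K₁ K₂ : ℝ → ℝ → Mr r} (h₁ : IsKernelN τ K₁)
    (h₂ : IsKernelN τ K₂) {x : ℝ} (hx : x ∈ Icc (0 : ℝ) 1) :
    ∀ᵐ t ∂volume.restrict (Ioc 0 x), K₁ x t = K₂ x t := by
  have h0 : (0 : ℝ) ∈ Icc (0 : ℝ) 1 := left_mem_Icc.2 zero_le_one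
  have i1 := intervalIntegrable_of_memLp_mu01 (h₁.1.memLp_left x hx) h0 hx
  have i2 := intervalIntegrable_of_memLp_mu01 (h₂.1.memLp_left x hx) h0 hx
  have h3 := ae_eq_zero_of_integral_cos_smul hx (i1.sub i2) fun l => by
    obtain ⟨⟨φ, hφ⟩, hk⟩ := h₁.2 l
    have e := add_left_cancel ((hk φ hφ x hx).symm.trans ((h₂.2 l).2 φ hφ x hx))
    have j1 : IntervalIntegrable (fun t : ℝ => Complex.cos (l * t) • K₁ x t) volume 0 x :=
      i1.continuousOn_smul (by fun_prop)
    have j2 : IntervalIntegrable (fun t : ℝ => Complex.cos (l * t) • K₂ x t) volume 0 x :=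
      i2.continuousOn_smul (by fun_prop)
    rw [← sub_eq_zero, ← intervalIntegral.integral_sub j1 j2] at e
    rw [← e]
    refine intervalIntegral.integral_congr fun t _ => ?_
    rw [← smul_sub, ← Complex.coe_smul]
    push_cast
    rfl
  filter_upwards [h3] with t ht
  exact sub_eq_zero.1 ht

end TransKernel

/-! ### Almost-everywhere statements on the triangle -/

section Triangle

open scoped ENNReal

variable {A : Type*} [NormedRing A]

theorem ae_ae_of_ae_Omega {P : ℝ × ℝ → Prop} (h : ∀ᵐ p ∂volume.restrict Omega, P p) :
    ∀ᵐ x ∂mu01, ∀ᵐ t ∂volume.restrict (Ioc 0 x), P (x, t) := by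
  rw [ae_restrict_iff' measurableSet_Omega, Measure.volume_eq_prod] at h
  filter_upwards [ae_restrict_of_ae (Measure.ae_ae_of_ae_prod h),
    ae_restrict_mem measurableSet_Ioo] with x hx hx1
  filter_upwards [ae_restrict_of_ae hx, ae_restrict_mem measurableSet_Ioc] with t ht ht1
  exact ht ⟨ht1.1.le, ht1.2, hx1.2.le⟩

/-- Passing from slices back to the plane requires a measurable exceptional set, hence the strongly
measurable representative `D` of the difference. -/
theorem ae_eq_on_Omega {F G : ℝ × ℝ → A} (hF : AEStronglyMeasurable F (volume.restrict Omega))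
    (hG : AEStronglyMeasurable G (volume.restrict Omega))
    (h : ∀ᵐ x ∂mu01, ∀ᵐ t ∂volume.restrict (Ioc 0 x), F (x, t) = G (x, t)) :
    ∀ᵐ p ∂volume.restrict Omega, F p = G p := by
  have hD : AEStronglyMeasurable (Omega.indicator (F - G)) (volume.prod volume) :=
    (aestronglyMeasurable_indicator_iff measurableSet_Omega).2 (hF.sub hG)
  obtain ⟨D, hDm, hDe⟩ := hD
  have hS : MeasurableSet {p | D p = 0} := hDm.measurableSet_eq_fun stronglyMeasurable_const
  have h01 : ∀ᵐ x : ℝ, x ∈ Ioo (0 : ℝ) 1 → ∀ᵐ t ∂volume.restrict (Ioc 0 x), F (x, t) = G (x, t) :=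
    (ae_restrict_iff' measurableSet_Ioo).1 h
  have hx0 : ∀ᵐ x : ℝ, x ≠ 0 := by simp [ae_iff]
  have hx1 : ∀ᵐ x : ℝ, x ≠ 1 := by simp [ae_iff]
  have h1 : ∀ᵐ p ∂(volume.prod volume : Measure (ℝ × ℝ)), D p = 0 := by
    rw [Measure.ae_prod_iff_ae_ae hS]
    filter_upwards [Measure.ae_ae_of_ae_prod hDe, h01, hx0, hx1] with x hx hx' hne0 hne1
    by_cases hxI : x ∈ Ioo (0 : ℝ) 1
    · filter_upwards [hx, (ae_restrict_iff' measurableSet_Ioc).1 (hx' hxI), hx0] with t ht ht' ht0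
      rw [← ht]
      by_cases hm : (x, t) ∈ Omega
      · rw [indicator_of_mem hm, Pi.sub_apply, sub_eq_zero]
        exact ht' ⟨lt_of_le_of_ne hm.1 ht0.symm, hm.2.1⟩
      · exact indicator_of_notMem hm _
    · filter_upwards [hx] with t ht
      rw [← ht]
      refine indicator_of_notMem (fun hm => hxI ⟨?_, lt_of_le_of_ne hm.2.2 hne1⟩) _
      exact lt_of_le_of_ne (hm.1.trans hm.2.1) hne0.symm
  rw [ae_restrict_iff' measurableSet_Omega, Measure.volume_eq_prod]
  filter_upwards [hDe, h1] with p hp hp' hm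
  rw [hp', indicator_of_mem hm, Pi.sub_apply, sub_eq_zero] at hp
  exact hp

theorem ae_memLp_left_of_memLp_Omega {R : ℝ → ℝ → A}
    (hR : MemLp (fun p : ℝ × ℝ => R p.1 p.2) 2 (volume.restrict Omega)) :
    ∀ᵐ x ∂mu01, MemLp (R x) 2 (volume.restrict (Ioc 0 x)) := by
  have h1 := (memLp_indicator_iff_restrict measurableSet_Omega).2 hR
  rw [Measure.volume_eq_prod] at h1
  have h2 := h1.1.prodMk_left
  have h3 := ((memLp_two_iff_integrable_sq_norm h1.1).1 h1).prod_right_ae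
  filter_upwards [ae_restrict_of_ae h2, ae_restrict_of_ae h3, ae_restrict_mem measurableSet_Ioo]
    with x hx2 hx3 hx
  refine (memLp_congr_ae ?_).1 (((memLp_two_iff_integrable_sq_norm hx2).2 hx3).restrict (Ioc 0 x))
  refine ae_restrict_of_forall_mem measurableSet_Ioc fun t ht => ?_
  exact indicator_of_mem (show (x, t) ∈ Omega from ⟨ht.1.le, ht.2, hx.2.le⟩) _

/-- Since `R` is known only almost everywhere, evaluating it at `(x,(x±t)/2)` is meaningful because
these maps pull null sets back to null sets. -/
theorem quasiMeasurePreserving_shear {f : ℝ → ℝ → ℝ} (hf : Measurable (Function.uncurry f))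
    (h : ∀ x, Measure.QuasiMeasurePreserving (f x) volume volume) :
    Measure.QuasiMeasurePreserving (fun p : ℝ × ℝ => (p.1, f p.1 p.2)) volume volume := by
  have hm : Measurable fun p : ℝ × ℝ => (p.1, f p.1 p.2) := measurable_fst.prodMk hf
  refine ⟨hm, Measure.AbsolutelyContinuous.mk fun s hs h0 => ?_⟩
  rw [Measure.map_apply hm hs, Measure.volume_eq_prod, Measure.measure_prod_null (hm hs)]
  rw [Measure.volume_eq_prod, Measure.measure_prod_null hs] at h0
  filter_upwards [h0] with x hx
  exact (h x).preimage_null hx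

theorem quasiMeasurePreserving_div_two :
    Measure.QuasiMeasurePreserving (fun s : ℝ => s / 2) volume volume := by
  refine ⟨by fun_prop, ?_⟩
  simp only [div_eq_inv_mul]
  rw [Real.map_volume_mul_left (by norm_num)]
  exact Measure.AbsolutelyContinuous.rfl.smul_left _

theorem ae_Omega_add_half {P : ℝ × ℝ → Prop} (h : ∀ᵐ p ∂volume.restrict Omega, P p) :
    ∀ᵐ p ∂volume.restrict Omega, P (p.1, (p.1 + p.2) / 2) := by
  have hq := quasiMeasurePreserving_shear (f := fun x t => (x + t) / 2) (by fun_prop)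
    fun x => quasiMeasurePreserving_div_two.comp
      (measurePreserving_add_left volume x).quasiMeasurePreserving
  rw [ae_restrict_iff' measurableSet_Omega] at h ⊢
  filter_upwards [hq.ae h] with p hp hm
  obtain ⟨h1, h2, h3⟩ := hm
  exact hp ⟨by dsimp only; linarith, by dsimp only; linarith, h3⟩

theorem ae_Omega_sub_half {P : ℝ × ℝ → Prop} (h : ∀ᵐ p ∂volume.restrict Omega, P p) :
    ∀ᵐ p ∂volume.restrict Omega, P (p.1, (p.1 - p.2) / 2) := by
  have hq := quasiMeasurePreserving_shear (f := fun x t => (x - t) / 2) (by fun_prop)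
    fun x => quasiMeasurePreserving_div_two.comp
      (Measure.measurePreserving_sub_left volume x).quasiMeasurePreserving
  rw [ae_restrict_iff' measurableSet_Omega] at h ⊢
  filter_upwards [hq.ae h] with p hp hm
  obtain ⟨h1, h2, h3⟩ := hm
  exact hp ⟨by dsimp only; linarith, by dsimp only; linarith, h3⟩

theorem Omega_subset_unitSquare : Omega ⊆ Icc (0 : ℝ) 1 ×ˢ Icc (0 : ℝ) 1 := fun _ hp =>
  ⟨⟨hp.1.trans hp.2.1, hp.2.2⟩, ⟨hp.1, hp.2.1.trans hp.2.2⟩⟩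

end Triangle

/-! ### Uniqueness of the Krein solution and reduction to an exactly even accelerant -/

section KreinSolution

open scoped ENNReal unitInterval

variable {r : ℕ} {H H' : ℝ → Mr r} {R : ℝ → ℝ → Mr r}

theorem ae_sub_of_ae_Icc (h : ∀ᵐ x, x ∈ Icc (-1 : ℝ) 1 → H x = H' x) (t : ℝ) :
    ∀ᵐ ξ, ξ - t ∈ Icc (-1 : ℝ) 1 → H (ξ - t) = H' (ξ - t) :=
  (measurePreserving_sub_right volume t).quasiMeasurePreserving.ae h

theorem IsKreinSolution.congr (hR : IsKreinSolution H R)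
    (h : ∀ᵐ x, x ∈ Icc (-1 : ℝ) 1 → H x = H' x) : IsKreinSolution H' R := by
  refine ⟨hR.memLp, ?_⟩
  have h1 : ∀ᵐ p : ℝ × ℝ, p.1 - p.2 ∈ Icc (-1 : ℝ) 1 → H (p.1 - p.2) = H' (p.1 - p.2) :=
    (quasiMeasurePreserving_sub volume volume).ae h
  filter_upwards [hR.eqn, ae_restrict_of_ae h1, ae_restrict_mem measurableSet_Omega]
    with p hp hp1 hm
  obtain ⟨h0, h2, h3⟩ := hm
  rw [← hp, hp1 ⟨by linarith, by linarith⟩]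
  congr 1
  refine intervalIntegral.integral_congr_ae ?_
  filter_upwards [ae_sub_of_ae_Icc h p.2] with ξ hξ hξm
  rw [uIoc_of_le (h0.trans h2)] at hξm
  rw [hξ ⟨by linarith [hξm.1], by linarith [hξm.2]⟩]

theorem theta_congr (h : ∀ᵐ x, x ∈ Icc (-1 : ℝ) 1 → H x = H' x) (R : ℝ → ℝ → Mr r) :
    ∀ᵐ x ∂mu01, theta H R x = theta H' R x := by
  filter_upwards [ae_restrict_of_ae h, ae_restrict_mem measurableSet_Ioo] with x hx hm
  rw [theta, theta, hx ⟨by linarith [hm.1], hm.2.le⟩]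
  congr 1
  refine intervalIntegral.integral_congr_ae ?_
  filter_upwards [h] with ξ hξ hξm
  rw [uIoc_of_le hm.1.le] at hξm
  rw [hξ ⟨by linarith [hξm.1], by linarith [hξm.2, hm.2]⟩]

/-- Every accelerant agrees almost everywhere on `[-1,1]` with an exactly even accelerant that is
square-integrable on the line. -/
theorem IsAccelerant.exists_even (hH : IsAccelerant H) : ∃ H' : ℝ → Mr r, IsAccelerant H' ∧
    MemLp H' 2 volume ∧ (∀ x, H' (-x) = H' x) ∧ ∀ᵐ x, x ∈ Icc (-1 : ℝ) 1 → H x = H' x := by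
  -- Using `|x|` makes evenness hold at every point; the cut-off gives an L² function on the line.
  set H' : ℝ → Mr r := (Ioo (-1 : ℝ) 1).indicator fun x => H |x| with hH'
  have habs : ∀ᵐ x ∂volume.restrict (Ioo (-1 : ℝ) 1), H x = H |x| := by
    filter_upwards [hH.even] with x hx
    rcases abs_choice x with h | h <;> rw [h]
    exact hx.symm
  have hae : ∀ᵐ x ∂volume.restrict (Ioo (-1 : ℝ) 1), H x = H' x := by
    filter_upwards [habs, ae_restrict_mem measurableSet_Ioo] with x hx hm
    rw [hx, hH', indicator_of_mem hm]
  have hIcc : ∀ᵐ x, x ∈ Icc (-1 : ℝ) 1 → H x = H' x := by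
    rw [← ae_restrict_iff' measurableSet_Icc, ← Measure.restrict_congr_set Ioo_ae_eq_Icc]
    exact hae
  have heven : ∀ x, H' (-x) = H' x := fun x => by
    simp only [hH', indicator, mem_Ioo, abs_neg]
    congr 1
    exact propext ⟨fun h => ⟨by linarith [h.2], by linarith [h.1]⟩,
      fun h => ⟨by linarith [h.2], by linarith [h.1]⟩⟩
  refine ⟨H', ⟨(memLp_congr_ae hae).1 hH.memLp, Eventually.of_forall heven, fun a ha f hf h => ?_⟩,
    (memLp_indicator_iff_restrict measurableSet_Ioo).2 ((memLp_congr_ae habs).1 hH.memLp), heven,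
    hIcc⟩
  refine hH.trivial_ker a ha f hf ?_
  filter_upwards [h, ae_restrict_mem measurableSet_Ioo] with x hx hm
  rw [← hx]
  congr 1
  refine intervalIntegral.integral_congr_ae ?_
  filter_upwards [(Measure.measurePreserving_sub_left volume x).quasiMeasurePreserving.ae hIcc]
    with t ht htm
  rw [uIoc_of_le ha.1] at htm
  rw [ht ⟨by linarith [hm.1, htm.2, ha.2], by linarith [hm.2, htm.1]⟩]

theorem IsAccelerant.exists_isKreinPair (hH : IsAccelerant H) (hL : MemLp H 2 volume)
    (he : ∀ x, H (-x) = H x) : ∃ C, IsKreinPair H C := by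
  obtain ⟨C, hc, hC⟩ := exists_continuous_krein hL (isUnit_one_add_convOp_mul hL hH he)
  exact ⟨C, hL, he, hc, hC⟩

variable {C : ℝ → ℝ → Mr r}

theorem IsKreinPair.isKreinSolution (hC : IsKreinPair H C) :
    IsKreinSolution H fun x t => -H (x - t) - C x t := by
  refine ⟨?_, ?_⟩
  · have h1 := memLp_restrict_unitSquare
      (memLp_two_sub_prod hC.memLp (volume.restrict (Icc (0 : ℝ) 1)))
    have h2 := hC.continuous.memLp_restrict_prod (isCompact_Icc (a := (0 : ℝ)) (b := 1))
      (isCompact_Icc (a := (0 : ℝ)) (b := 1))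
    exact (h1.neg.sub h2).mono_measure (Measure.restrict_mono Omega_subset_unitSquare le_rfl)
  · refine ae_restrict_of_forall_mem measurableSet_Omega fun p hp => ?_
    rw [← hC.eqn p.1 ⟨hp.1.trans hp.2.1, hp.2.2⟩ p.2]
    abel

/-- On almost every slice the difference `g` from the known kernel solves the homogeneous equation,
a priori only in L². It agrees almost everywhere with the continuous function `G`, which solves that
equation everywhere and is killed by the a priori bound with `m = 0`. -/
theorem IsKreinSolution.ae_ae_eq (hR : IsKreinSolution H R) (hC : IsKreinPair H C)
    (hU : ∀ a : I, IsUnit (1 + convOp (ContinuousLinearMap.mul ℂ (Mr r)) hC.memLp a)) :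
    ∀ᵐ x ∂mu01, ∀ᵐ t ∂volume.restrict (Ioc 0 x), R x t = kreinKernel H C x t := by
  obtain ⟨M, -, hM⟩ := exists_bound_of_isUnit hC.memLp hU
  filter_upwards [ae_ae_of_ae_Omega hR.eqn, ae_memLp_left_of_memLp_Omega hR.memLp,
    ae_restrict_mem measurableSet_Ioo] with x hx hxL hxm
  have hx' : x ∈ Ioc (0 : ℝ) 1 := Ioo_subset_Ioc_self hxm
  set g : ℝ → Mr r := fun ξ => R x ξ - kreinKernel H C x ξ with hg
  have hgL : MemLp ((Ioc 0 x).indicator g) 2 volume :=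
    (memLp_indicator_iff_restrict measurableSet_Ioc).2 (hxL.sub (hC.memLp_kernel_left x 0 x))
  set G : ℝ → Mr r := fun t => -∫ ξ in (0 : ℝ)..x, g ξ * H (ξ - t) with hG
  have hGc : Continuous G := by
    refine (((l2Continuous_const hgL).intervalIntegral_mul (l2Continuous_translate hC.memLp)
      (continuous_const (y := 0)) (continuous_const (y := x))).neg).congr fun t => ?_
    simp only [hG, Pi.neg_apply]
    congr 1
    refine intervalIntegral.integral_congr_ae (Eventually.of_forall fun ξ hξ => ?_)
    rw [uIoc_of_le hx'.1.le] at hξ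
    rw [indicator_of_mem hξ]
  have hgG : ∀ᵐ t ∂volume.restrict (Ioc 0 x), g t = G t := by
    filter_upwards [hx] with t ht
    have iH := (memLp_translate hC.memLp t).restrict (Ioc 0 x)
    have i1 : IntervalIntegrable (fun ξ => R x ξ * H (ξ - t)) volume 0 x :=
      (intervalIntegrable_iff_integrableOn_Ioc_of_le hx'.1.le).2 (hxL.integrable_mul iH)
    have i2 : IntervalIntegrable (fun ξ => kreinKernel H C x ξ * H (ξ - t)) volume 0 x :=
      (intervalIntegrable_iff_integrableOn_Ioc_of_le hx'.1.le).2
        ((hC.memLp_kernel_left x 0 x).integrable_mul iH)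
    have h2 := hC.eqn x (Ioc_subset_Icc_self hx') t
    simp only [← kreinKernel_of_mem H C hx'] at h2
    simp only [hG, hg, sub_mul]
    rw [intervalIntegral.integral_sub i1 i2, ← h2, kreinKernel_of_mem H C hx']
    rw [add_assoc, add_eq_zero_iff_eq_neg] at ht
    rw [ht]
    abel
  have hG0 : ∀ t ∈ Icc (0 : ℝ) 1, G t = 0 := by
    intro t ht
    have h1 := hM x (Ioc_subset_Icc_self hx') G (fun _ => 0) hGc.continuousOn continuousOn_const 0
      (fun s _ => ?_) (fun s _ => by simp) t ht
    · rwa [mul_zero, norm_le_zero_iff] at h1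
    · have : ∫ ξ in (0 : ℝ)..x, G ξ * H (ξ - s) = ∫ ξ in (0 : ℝ)..x, g ξ * H (ξ - s) := by
        refine intervalIntegral.integral_congr_ae ?_
        rw [uIoc_of_le hx'.1.le]
        filter_upwards [(ae_restrict_iff' measurableSet_Ioc).1 hgG] with ξ hξ hm
        rw [hξ hm]
      rw [this]
      simp only [hG, neg_add_cancel]
  filter_upwards [hgG, ae_restrict_mem measurableSet_Ioc] with t ht hm
  rw [hG0 t ⟨hm.1.le, hm.2.trans hx'.2⟩] at ht
  exact sub_eq_zero.1 ht

theorem IsKreinSolution.ae_eq (hR : IsKreinSolution H R) (hC : IsKreinPair H C)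
    (hU : ∀ a : I, IsUnit (1 + convOp (ContinuousLinearMap.mul ℂ (Mr r)) hC.memLp a)) :
    ∀ᵐ p ∂volume.restrict Omega, R p.1 p.2 = -H (p.1 - p.2) - C p.1 p.2 := by
  refine ae_eq_on_Omega (F := fun p => R p.1 p.2) hR.memLp.1 hC.isKreinSolution.memLp.1 ?_
  filter_upwards [hR.ae_ae_eq hC hU, ae_restrict_mem measurableSet_Ioo] with x hx hm
  filter_upwards [hx] with t ht
  rw [ht, kreinKernel_of_mem H C (Ioo_subset_Ioc_self hm)]

/-- The line `t = 0` is null in the triangle, so the Krein equation for `R` cannot be read there.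
The equation for `C` holds at every `t`, and at `t = 0` its integral is the one in `theta`. -/
theorem IsKreinSolution.theta_ae_eq (hR : IsKreinSolution H R) (hC : IsKreinPair H C)
    (hU : ∀ a : I, IsUnit (1 + convOp (ContinuousLinearMap.mul ℂ (Mr r)) hC.memLp a)) :
    ∀ᵐ x ∂mu01, theta H R x = kreinPotential H C x := by
  filter_upwards [hR.ae_ae_eq hC hU, ae_restrict_mem measurableSet_Ioo] with x hx hm
  have hm' : x ∈ Ioc (0 : ℝ) 1 := Ioo_subset_Ioc_self hm
  have h1 : ∫ ξ in (0 : ℝ)..x, R x ξ * H ξ =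
      ∫ ξ in (0 : ℝ)..x, (-H (x - ξ) - C x ξ) * H (ξ - 0) := by
    refine intervalIntegral.integral_congr_ae ?_
    rw [uIoc_of_le hm'.1.le]
    filter_upwards [(ae_restrict_iff' measurableSet_Ioc).1 hx] with ξ hξ hξm
    rw [hξ hξm, kreinKernel_of_mem H C hm', sub_zero]
  rw [theta, h1, ← hC.eqn x (Ioc_subset_Icc_self hm') 0, kreinPotential,
    kreinKernel_of_mem H C hm', sub_zero]
  abel

/-- A kernel in `G₂⁺` that agrees with `transKernel` on almost all slices is given on the triangle
by the Krein solution. -/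
theorem InG2Plus.ae_eq_half {K : ℝ → ℝ → Mr r} (hK : InG2Plus K) (hC : IsKreinPair H C) {ε : ℂ}
    (h : ∀ x ∈ Icc (0 : ℝ) 1, ∀ᵐ t ∂volume.restrict (Ioc 0 x), K x t = transKernel H C ε x t)
    (hR : ∀ᵐ p ∂volume.restrict Omega, R p.1 p.2 = -H (p.1 - p.2) - C p.1 p.2) :
    ∀ᵐ p ∂volume.restrict Omega, K p.1 p.2 =
      (1 / 2 : ℂ) • (R p.1 ((p.1 + p.2) / 2) + ε • R p.1 ((p.1 - p.2) / 2)) := by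
  have hle : volume.restrict Omega ≤ volume.restrict (Icc (0 : ℝ) 1 ×ˢ Icc (0 : ℝ) 1) :=
    Measure.restrict_mono Omega_subset_unitSquare le_rfl
  have h1 := ae_eq_on_Omega (F := fun p => K p.1 p.2) (hK.memLp.1.mono_measure hle)
    ((hC.memLp_transKernel ε).1.mono_measure hle)
    ((ae_restrict_mem measurableSet_Ioo).mono fun x hx => h x (Ioo_subset_Icc_self hx))
  filter_upwards [h1, ae_Omega_add_half hR, ae_Omega_sub_half hR,
    ae_restrict_mem measurableSet_Omega] with p hp ha hs hm
  rw [hp, transKernel_of_mem H C ε ⟨hm.1, hm.2.1⟩, ha, hs]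

end KreinSolution

theorem theorem1p6 {r : ℕ} (H : ℝ → Mr r) (hH : IsAccelerant H) :
    -- the Krein equation has a solution, unique in `L_2(Ω, M_r)`
    (∃ R : ℝ → ℝ → Mr r, IsKreinSolution H R ∧
      ∀ R' : ℝ → ℝ → Mr r, IsKreinSolution H R' →
        ∀ᵐ p ∂(volume.restrict Omega), R' p.1 p.2 = R p.1 p.2) ∧
    -- with `R = R_H` and `τ = Θ(H)`:
    ∀ R : ℝ → ℝ → Mr r, IsKreinSolution H R →
    ∀ τ : ℝ → Mr r, (∀ᵐ x ∂mu01, τ x = theta H R x) →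
      MemLp τ 2 mu01 ∧
      -- the kernels `K_{τ,D}` and `K_{τ,N}` exist
      (∃ KD : ℝ → ℝ → Mr r, IsKernelD τ KD) ∧
      (∃ KN : ℝ → ℝ → Mr r, IsKernelN τ KN) ∧
      -- and they are given by the formulas (which determine them as elements of `L_2(Ω, M_r)`)
      (∀ KD : ℝ → ℝ → Mr r, IsKernelD τ KD →
        ∀ᵐ p ∂(volume.restrict Omega), KD p.1 p.2 =
          (1 / 2 : ℂ) • (R p.1 ((p.1 + p.2) / 2) - R p.1 ((p.1 - p.2) / 2))) ∧
      (∀ KN : ℝ → ℝ → Mr r, IsKernelN τ KN →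
        ∀ᵐ p ∂(volume.restrict Omega), KN p.1 p.2 =
          (1 / 2 : ℂ) • (R p.1 ((p.1 + p.2) / 2) + R p.1 ((p.1 - p.2) / 2))) := by

  obtain ⟨H', hH', hL, he, hHH'⟩ := hH.exists_even
  have hH'H : ∀ᵐ x, x ∈ Icc (-1 : ℝ) 1 → H' x = H x := hHH'.mono fun x h hx => (h hx).symm
  obtain ⟨C, hC⟩ := hH'.exists_isKreinPair hL he
  have hU := isUnit_one_add_convOp_mul hL hH' he
  -- Every solution coincides with one explicit kernel, which settles uniqueness and also feeds the
  -- final formulas.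
  have hR : ∀ R, IsKreinSolution H R →
      ∀ᵐ p ∂volume.restrict Omega, R p.1 p.2 = -H' (p.1 - p.2) - C p.1 p.2 := fun R h =>
    (h.congr hHH').ae_eq hC hU
  refine ⟨⟨_, hC.isKreinSolution.congr hH'H, hR⟩, fun R hRs τ hτ => ?_⟩
  have hτ' : ∀ᵐ x ∂mu01, τ x = kreinPotential H' C x := by
    filter_upwards [hτ, theta_congr hHH' R, (hRs.congr hHH').theta_ae_eq hC hU] with x h1 h2 h3
    rw [h1, h2, h3]
  have hτL : MemLp τ 2 mu01 := (memLp_congr_ae hτ').2 (hC.memLp_potential.restrict _)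
  have hBK : ∀ x ∈ Icc (0 : ℝ) 1, ∀ u ∈ Icc (0 : ℝ) 1, C x (x - u) =
      C u 0 + ∫ y in u..x, kreinPotential H' C y * kreinKernel H' C y u :=
    fun x hx u hu => hC.bellman_krein hU hx hu
  have hD := isKernelD_transKernel hC hBK hτL hτ'
  have hN := isKernelN_transKernel hC hBK hτL hτ'
  refine ⟨hτL, ⟨_, hD⟩, ⟨_, hN⟩, fun K hK => ?_, fun K hK => ?_⟩
  · filter_upwards [hK.1.ae_eq_half hC (fun x hx => hK.ae_eq hD hx) (hR R hRs)] with p hp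
    rw [hp, neg_one_smul, ← sub_eq_add_neg]
  · filter_upwards [hK.1.ae_eq_half hC (fun x hx => hK.ae_eq hN hx) (hR R hRs)] with p hp
    rw [hp, one_smul]
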